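/- Let $n\ge 1$ and let $Q^{(n)}$ be the graph of the $n$-dimensional cube: its vertex set is $\{0,1\}^n$, and two vertices are adjacent if and only if they differ in exactly one entry. A numbering of a graph $G=(V,E)$ is a bijection $\eta: V\to\{1,2,\dots,|V|\}$, and the antibandwidth of $G$ is $$f(G)=\max_{\eta}\ \min_{\{v,w\}\in E}|\eta(v)-\eta(w)|,$$ where the maximum is over all numberings $\eta$ of $G$. Then $$f(Q^{(n)})=2^{n-1}-\sum_{m=0}^{n-2}\binom{m}{\lfloor m/2\rfloor},$$ where the sum is empty if $n=1$. -/

import Mathlib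

/-- The graph of the `n`-dimensional cube: the vertices are the `n`-tuples of zeros and ones, and
two vertices are adjacent iff they differ in exactly one entry. -/
def hypercubeGraph (n : ℕ) : SimpleGraph (Fin n → Bool) where
  Adj u v := hammingDist u v = 1
  symm := ⟨fun u v h => by rw [hammingDist_comm]; exact h⟩
  loopless := ⟨fun u h => by simp at h⟩

/-- A numbering of a finite vertex set `V`: a bijection from `V` onto `{1, 2, …, |V|}`. -/
def IsNumbering {V : Type*} [Fintype V] (η : V → ℕ) : Prop :=
  Set.BijOn η Set.univ (Set.Icc 1 (Fintype.card V))

/-- The label differences `|η v - η w|` across the edges `{v, w}` of `G`. -/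
def edgeLabelDiffs {V : Type*} (G : SimpleGraph V) (η : V → ℕ) : Set ℤ :=
  {d | ∃ v w : V, G.Adj v w ∧ d = |(η v : ℤ) - (η w : ℤ)|}

/-- `IsAntibandwidth G f` says that `f` is the antibandwidth of `G`, that is, the maximum, over all
numberings `η` of `G`, of the minimum of `|η v - η w|` over the edges `{v, w}` of `G`. Both the
minimum and the maximum are required to exist, and they determine `f` uniquely. -/
def IsAntibandwidth {V : Type*} [Fintype V] (G : SimpleGraph V) (f : ℤ) : Prop :=
  IsGreatest {d : ℤ | ∃ η : V → ℕ, IsNumbering η ∧ IsLeast (edgeLabelDiffs G η) d} f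

/-! Write n = m + 1 and let c be the sum of central binomial coefficients in the formula. Deleting
one coordinate maps each parity class of the cube bijectively onto the m-cube, and vertices of
opposite parity are adjacent exactly when their images are at distance at most 1. Both bounds become
statements about this half cube.

Lower bound: order the half cube by size and, within a layer, put sets with larger elements first.
Sets at distance at most 1 then differ in rank by at most c (`cubeRank_le_add`). Labelling the even
vertices first and the odd ones afterwards, in the same order, makes every edge difference at least
2^m - c.

Upper bound: let s be the size of `peakFamily m`, roughly half of the half cube. Harper's inequality
at this one size says that two separated families, one of them with s members, together miss at
least c sets (`card_add_card_le_of_separated`). It is proved by compressing the two families in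
opposite directions until the first is an initial segment of the simplicial order. If all edge
differences were at least k = 2^m - c + 1, then of two concentric label windows of total length 2k,
one could not hold s vertices of one parity while the other holds k - s of the other parity. No
balanced sequence of parities avoids all such pairs of windows
(`BalancedCounts.false_of_windowFree`). -/

open scoped symmDiff

/-! ### Compressions of separated pairs -/

/-- Two set families are separated if no member of one is equal to a member of the other or
differs from it in a single element. -/
def Separated (A B : Finset (Finset ℕ)) : Prop :=
  ∀ a ∈ A, ∀ b ∈ B, 2 ≤ (a ∆ b).card

lemma Separated.symm {A B : Finset (Finset ℕ)} (h : Separated A B) : Separated B A := by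
  intro b hb a ha
  rw [symmDiff_comm]
  exact h a ha b hb

/-- The family is closed under replacing `v` by `u` in its members. -/
def ReplaceClosed (u v : Finset ℕ) (A : Finset (Finset ℕ)) : Prop :=
  ∀ a ∈ A, Disjoint u a → v ⊆ a → (a ∪ u) \ v ∈ A

lemma replace_eq_symmDiff {u v a : Finset ℕ} (huv : Disjoint u v) (hua : Disjoint u a)
    (hva : v ⊆ a) : (a ∪ u) \ v = a ∆ (u ∪ v) := by
  rw [Finset.disjoint_left] at huv hua
  ext z
  have h1 := @huv z
  have h2 := @hua z
  have h3 := @hva z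
  simp only [Finset.mem_symmDiff, Finset.mem_sdiff, Finset.mem_union]
  by_cases z ∈ u <;> by_cases z ∈ v <;> by_cases z ∈ a <;> simp_all

/-- Suppose the moved set comes within distance 1 of `b`. Either `b` is itself replaceable, and its
replacement lies at that same distance from `a`; or the only discrepancy is some `x` in `u` or `v`.
Then undoing the move on `b` with `x` left out (and perhaps one `y` from the other side) gives a
member of `B` within distance 1 of `a`. -/
lemma separated_replace_aux {A B : Finset (Finset ℕ)} {u v a b : Finset ℕ}
    (huv : Disjoint u v) (hAB : Separated A B) (haA : a ∈ A) (hua : Disjoint u a) (hva : v ⊆ a)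
    (hbB : b ∈ B) (hb : Disjoint v b → u ⊆ b → (b ∪ v) \ u ∈ B)
    (hu : ∀ x ∈ u, ReplaceClosed v (u.erase x) B ∨ ∃ y ∈ v, ReplaceClosed (v.erase y) (u.erase x) B)
    (hv : ∀ x ∈ v, ReplaceClosed (v.erase x) u B ∨ ∃ y ∈ u, ReplaceClosed (v.erase x) (u.erase y) B) :
    2 ≤ (((a ∪ u) \ v) ∆ b).card := by
  by_contra! hlt
  have huv' := huv
  have hua' := hua
  rw [Finset.disjoint_left] at huv hua
  have key : ∀ b' ∈ B, ∀ y, (∀ z, z ∈ a ∆ b' → z = y) → False := by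
    intro b' hb' y h
    have h1 := hAB a haA b' hb'
    have h2 : (a ∆ b').card ≤ ({y} : Finset ℕ).card :=
      Finset.card_le_card (fun z hz => by simpa using h z hz)
    simp at h2
    omega
  by_cases h1 : u ⊆ b
  · by_cases h2 : Disjoint v b
    · have h3 := hAB a haA _ (hb h2 h1)
      have h4 : a ∆ ((b ∪ v) \ u) = ((a ∪ u) \ v) ∆ b := by
        rw [replace_eq_symmDiff huv'.symm h2 h1, replace_eq_symmDiff huv' hua' hva,
          Finset.union_comm v u, symmDiff_assoc, symmDiff_comm b]
      rw [h4] at h3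
      omega
    · rw [Finset.not_disjoint_iff] at h2
      obtain ⟨x, hxv, hxb⟩ := h2
      have hx : ∀ z, z ∈ ((a ∪ u) \ v) ∆ b → z = x := by
        intro z hz
        have hx' : x ∈ ((a ∪ u) \ v) ∆ b := by
          simp [Finset.mem_symmDiff, hxv, hxb]
        exact Finset.card_le_one.1 (by omega) z hz x hx'
      simp only [Finset.mem_symmDiff, Finset.mem_sdiff, Finset.mem_union] at hx
      rcases hv x hxv with h | ⟨y, hy, h⟩
      · refine key _ (h b hbB ?_ h1) x ?_
        · rw [Finset.disjoint_left]
          intro z hz hzb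
          grind
        · intro z hz
          simp only [Finset.mem_symmDiff, Finset.mem_sdiff, Finset.mem_union, Finset.mem_erase] at hz
          grind
      · refine key _ (h b hbB ?_ ?_) y ?_
        · rw [Finset.disjoint_left]
          intro z hz hzb
          grind
        · exact (Finset.erase_subset _ _).trans h1
        · intro z hz
          simp only [Finset.mem_symmDiff, Finset.mem_sdiff, Finset.mem_union, Finset.mem_erase] at hz
          grind
  · rw [Finset.not_subset] at h1
    obtain ⟨x, hxu, hxb⟩ := h1
    have hx : ∀ z, z ∈ ((a ∪ u) \ v) ∆ b → z = x := by
      intro z hz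
      have hx' : x ∈ ((a ∪ u) \ v) ∆ b := by
        simp [Finset.mem_symmDiff, hxu, hxb, huv hxu]
      exact Finset.card_le_one.1 (by omega) z hz x hx'
    simp only [Finset.mem_symmDiff, Finset.mem_sdiff, Finset.mem_union] at hx
    rcases hu x hxu with h | ⟨y, hy, h⟩
    · refine key _ (h b hbB ?_ ?_) x ?_
      · rw [Finset.disjoint_left]
        intro z hz hzb
        grind
      · intro z hz
        grind
      · intro z hz
        simp only [Finset.mem_symmDiff, Finset.mem_sdiff, Finset.mem_union, Finset.mem_erase] at hz
        grind
    · refine key _ (h b hbB ?_ ?_) y ?_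
      · rw [Finset.disjoint_left]
        intro z hz hzb
        grind
      · intro z hz
        grind
      · intro z hz
        simp only [Finset.mem_symmDiff, Finset.mem_sdiff, Finset.mem_union, Finset.mem_erase] at hz
        grind

lemma mem_compression_cases {A : Finset (Finset ℕ)} {u v a : Finset ℕ}
    (ha : a ∈ UV.compression u v A) :
    (a ∈ A ∧ (Disjoint u a → v ⊆ a → (a ∪ u) \ v ∈ A)) ∨
      ∃ a' ∈ A, Disjoint u a' ∧ v ⊆ a' ∧ a = (a' ∪ u) \ v := by
  rw [UV.mem_compression] at ha
  rcases ha with ⟨h1, h2⟩ | ⟨h1, a', h2, h3⟩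
  · left
    refine ⟨h1, fun h3 h4 => ?_⟩
    rw [UV.compress, if_pos ⟨h3, h4⟩] at h2
    exact h2
  · right
    rw [UV.compress] at h3
    split_ifs at h3 with h4
    · exact ⟨a', h2, h4.1, h4.2, h3.symm⟩
    · exact absurd (h3 ▸ h2) h1

/-- When both members of a pair move, both are translated by `u ∪ v`, so their symmetric difference
is unchanged. Only the mixed pairs need the closure hypotheses. -/
lemma Separated.compression {A B : Finset (Finset ℕ)} {u v : Finset ℕ}
    (huv : Disjoint u v) (hAB : Separated A B)
    (huA : ∀ x ∈ u, ReplaceClosed (u.erase x) v A ∨ ∃ y ∈ v, ReplaceClosed (u.erase x) (v.erase y) A)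
    (hvA : ∀ x ∈ v, ReplaceClosed u (v.erase x) A ∨ ∃ y ∈ u, ReplaceClosed (u.erase y) (v.erase x) A)
    (huB : ∀ x ∈ u, ReplaceClosed v (u.erase x) B ∨ ∃ y ∈ v, ReplaceClosed (v.erase y) (u.erase x) B)
    (hvB : ∀ x ∈ v, ReplaceClosed (v.erase x) u B ∨ ∃ y ∈ u, ReplaceClosed (v.erase x) (u.erase y) B) :
    Separated (UV.compression u v A) (UV.compression v u B) := by
  intro a ha b hb
  rcases mem_compression_cases ha with ⟨h1, h2⟩ | ⟨a', h1, h2, h3, rfl⟩ <;>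
  rcases mem_compression_cases hb with ⟨g1, g2⟩ | ⟨b', g1, g2, g3, rfl⟩
  · exact hAB a h1 b g1
  · rw [symmDiff_comm]
    exact separated_replace_aux huv.symm hAB.symm g1 g2 g3 h1 h2 hvA huA
  · exact separated_replace_aux huv hAB h1 h2 h3 g1 g2 huB hvB
  · have h4 := hAB a' h1 b' g1
    have h5 : ((a' ∪ u) \ v) ∆ ((b' ∪ v) \ u) = a' ∆ b' := by
      rw [replace_eq_symmDiff huv.symm g2 g3, replace_eq_symmDiff huv h2 h3,
        Finset.union_comm v u, symmDiff_symmDiff_symmDiff_comm, symmDiff_self, symmDiff_bot]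
    rwa [h5]

/-! ### The simplicial order and reduction to initial segments -/

/-- The position weight of a subset of `{0, …, m - 1}`: smaller sets come first, and sets of the
same size are ordered by decreasing binary value. -/
def segWeight (m : ℕ) (a : Finset ℕ) : ℤ := ∑ i ∈ a, ((2 : ℤ) ^ m - 2 ^ i)

lemma segWeight_eq (m : ℕ) (a : Finset ℕ) :
    segWeight m a = 2 ^ m * a.card - ((∑ i ∈ a, 2 ^ i : ℕ) : ℤ) := by
  simp [segWeight, Finset.sum_sub_distrib, mul_comm]

lemma sum_two_pow_lt {m : ℕ} {a : Finset ℕ} (ha : a ⊆ Finset.range m) :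
    ∑ i ∈ a, 2 ^ i < 2 ^ m := by
  apply Nat.geomSum_lt (le_refl 2)
  intro k hk
  exact Finset.mem_range.1 (ha hk)

/-- Binary values stay below `2 ^ m`, so they cannot outweigh a difference in size. -/
lemma segWeight_lt_iff {m : ℕ} {a b : Finset ℕ} (ha : a ⊆ Finset.range m)
    (hb : b ⊆ Finset.range m) :
    segWeight m a < segWeight m b ↔
      a.card < b.card ∨ a.card = b.card ∧ ∑ i ∈ b, 2 ^ i < ∑ i ∈ a, 2 ^ i := by
  have h1 := sum_two_pow_lt ha
  have h2 := sum_two_pow_lt hb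
  rw [segWeight_eq, segWeight_eq]
  zify at h1 h2 ⊢
  have h3 : (0 : ℤ) ≤ ∑ i ∈ a, 2 ^ i := by positivity
  have h4 : (0 : ℤ) ≤ ∑ i ∈ b, 2 ^ i := by positivity
  have h5 : (0 : ℤ) < 2 ^ m := by positivity
  rcases lt_trichotomy a.card b.card with h | h | h
  · have : (a.card : ℤ) + 1 ≤ b.card := by exact_mod_cast h
    have h6 := mul_le_mul_of_nonneg_left this h5.le
    constructor
    · intro; left; omega
    · intro; linarith
  · rw [h]
    constructor
    · intro h; right; exact ⟨rfl, by linarith⟩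
    · rintro (h | ⟨-, h⟩)
      · omega
      · linarith
  · have : (b.card : ℤ) + 1 ≤ a.card := by exact_mod_cast h
    have h6 := mul_le_mul_of_nonneg_left this h5.le
    constructor
    · intro; exfalso; linarith
    · intro; omega

lemma segWeight_injOn {m : ℕ} {a b : Finset ℕ} (ha : a ⊆ Finset.range m)
    (hb : b ⊆ Finset.range m) (h : segWeight m a = segWeight m b) : a = b := by
  have h1 := (segWeight_lt_iff ha hb).not.1 h.not_lt
  have h2 := (segWeight_lt_iff hb ha).not.1 h.not_gt
  push Not at h1 h2
  have h3 : a.card = b.card := le_antisymm h2.1 h1.1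
  exact Finset.geomSum_injective (le_refl 2) (le_antisymm (h1.2 h3) (h2.2 h3.symm))

lemma segWeight_replace {m : ℕ} {u v a : Finset ℕ} (hua : Disjoint u a) (hva : v ⊆ a) :
    segWeight m ((a ∪ u) \ v) = segWeight m a + segWeight m u - segWeight m v := by
  unfold segWeight
  rw [Finset.sum_sdiff_eq_sub (hva.trans Finset.subset_union_left), Finset.sum_union hua.symm]

lemma segWeight_erase_lt {m : ℕ} {u : Finset ℕ} (hu : u ⊆ Finset.range m) {x : ℕ} (hx : x ∈ u) :
    segWeight m (u.erase x) < segWeight m u := by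
  rw [segWeight_lt_iff ((Finset.erase_subset _ _).trans hu) hu]
  left
  exact Finset.card_erase_lt_of_mem hx

/-- Removing any `x` from the later set can be matched by removing some element of the earlier
set. -/
lemma exists_segWeight_erase {m : ℕ} {u v : Finset ℕ} (hu : u ⊆ Finset.range m)
    (hv : v ⊆ Finset.range m) (huv : Disjoint u v) (h : segWeight m u < segWeight m v) {x : ℕ}
    (hx : x ∈ v) (hne : u.Nonempty) :
    ∃ y ∈ u, segWeight m (u.erase y) < segWeight m (v.erase x) ∨
      (u.erase y = ∅ ∧ v.erase x = ∅) := by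
  -- If the sizes agree, disjointness and the larger binary value put the maximum of `u` above all
  -- of `v`; it survives the removal of the minimum unless `u` is a singleton.
  refine ⟨u.min' hne, u.min'_mem hne, ?_⟩
  rw [segWeight_lt_iff ((Finset.erase_subset _ _).trans hu) ((Finset.erase_subset _ _).trans hv),
    Finset.card_erase_of_mem hx, Finset.card_erase_of_mem (u.min'_mem hne)]
  have hcu := hne.card_pos
  rcases (segWeight_lt_iff hu hv).1 h with h | ⟨h1, h2⟩
  · left; left; omega
  · by_cases hc : u.card = 1
    · right
      rw [← Finset.card_eq_zero, ← Finset.card_eq_zero, Finset.card_erase_of_mem hx,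
        Finset.card_erase_of_mem (u.min'_mem hne)]
      omega
    · left; right
      refine ⟨by omega, ?_⟩
      have hmax : u.max' hne ∈ u.erase (u.min' hne) := by
        refine Finset.mem_erase.2 ⟨?_, u.max'_mem hne⟩
        have := Finset.min'_lt_max'_of_card u (by omega)
        exact this.ne'
      have h3 : 2 ^ u.max' hne ≤ ∑ i ∈ u.erase (u.min' hne), 2 ^ i :=
        Finset.single_le_sum (f := fun i => 2 ^ i) (fun _ _ => Nat.zero_le _) hmax
      have h4 : v ⊆ Finset.range (u.max' hne) := by
        intro z hz
        rw [Finset.mem_range]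
        by_contra! hge
        rcases hge.eq_or_lt with heq | hlt
        · exact Finset.disjoint_left.1 huv (u.max'_mem hne) (heq ▸ hz)
        · have h5 : 2 ^ z ≤ ∑ i ∈ v, 2 ^ i :=
            Finset.single_le_sum (f := fun i => 2 ^ i) (fun _ _ => Nat.zero_le _) hz
          have h6 : u ⊆ Finset.range z := by
            intro t ht
            exact Finset.mem_range.2 ((u.le_max' t ht).trans_lt hlt)
          have := sum_two_pow_lt h6
          omega
      exact (sum_two_pow_lt ((Finset.erase_subset _ _).trans h4)).trans_le h3

/-- The weight is additive over elements, so every moved member changes it by the same amount. -/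
lemma sum_segWeight_compression (m : ℕ) (u v : Finset ℕ) (A : Finset (Finset ℕ)) :
    ∑ a ∈ UV.compression u v A, segWeight m a = ∑ a ∈ A, segWeight m a +
      (A.filter fun a => UV.compress u v a ∉ A).card * (segWeight m u - segWeight m v) := by
  have hdisj : Disjoint {a ∈ A | UV.compress u v a ∈ A}
      {a ∈ A.image (UV.compress u v) | a ∉ A} := by
    rw [Finset.disjoint_left]
    intro a ha hb
    exact (Finset.mem_filter.1 hb).2 (Finset.mem_filter.1 ha).1
  have hmoved : ∑ a ∈ {a ∈ A.image (UV.compress u v) | a ∉ A}, segWeight m a =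
      ∑ a ∈ A.filter (fun a => UV.compress u v a ∉ A),
        (segWeight m a + (segWeight m u - segWeight m v)) := by
    rw [Finset.filter_image, Finset.sum_image UV.compress_injOn]
    refine Finset.sum_congr rfl fun a ha => ?_
    rw [Finset.mem_filter] at ha
    have h := ha.2
    rw [UV.compress] at h ⊢
    split_ifs at h ⊢ with hc
    · have := segWeight_replace (m := m) hc.1 hc.2
      simp only [Finset.sup_eq_union]
      rw [this]
      ring
    · exact absurd ha.1 h
  rw [UV.compression, Finset.sum_union hdisj, hmoved, Finset.sum_add_distrib, Finset.sum_const,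
    ← Finset.sum_filter_add_sum_filter_not A (fun a => UV.compress u v a ∈ A) (segWeight m),
    nsmul_eq_mul, add_assoc]

lemma replaceClosed_of_card_eq_zero {u v : Finset ℕ} {A : Finset (Finset ℕ)}
    (h : (A.filter fun a => UV.compress u v a ∉ A).card = 0) : ReplaceClosed u v A := by
  intro a ha hua hva
  rw [Finset.card_eq_zero, Finset.filter_eq_empty_iff] at h
  have h1 := h ha
  rw [not_not, UV.compress, if_pos ⟨hua, hva⟩] at h1
  exact h1

lemma replaceClosed_empty (A : Finset (Finset ℕ)) : ReplaceClosed ∅ ∅ A := by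
  intro a ha _ _
  simpa using ha

lemma compression_subset_powerset {m : ℕ} {u v : Finset ℕ} {A : Finset (Finset ℕ)}
    (hu : u ⊆ Finset.range m) (hA : A ⊆ (Finset.range m).powerset) :
    UV.compression u v A ⊆ (Finset.range m).powerset := by
  intro a ha
  rcases mem_compression_cases ha with ⟨h, -⟩ | ⟨a', h, -, -, rfl⟩
  · exact hA h
  · have h1 := Finset.mem_powerset.1 (hA h)
    exact Finset.mem_powerset.2 (Finset.sdiff_subset.trans (Finset.union_subset h1 hu))

/-- Among separated pairs of the given sizes, take one minimising the weight of the first family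
minus that of the second. Once all smaller replacements are closed, compressing the two families in
opposite directions keeps them separated; it would lower this potential if anything moved. Induction
on `u.card + v.card` closes all replacements. -/
theorem exists_separated_replaceClosed {m : ℕ} {A B : Finset (Finset ℕ)}
    (hA : A ⊆ (Finset.range m).powerset) (hB : B ⊆ (Finset.range m).powerset)
    (hAB : Separated A B) :
    ∃ A' B' : Finset (Finset ℕ), A' ⊆ (Finset.range m).powerset ∧
      B' ⊆ (Finset.range m).powerset ∧ Separated A' B' ∧ A'.card = A.card ∧ B'.card = B.card ∧
      ∀ u v : Finset ℕ, u ⊆ Finset.range m → v ⊆ Finset.range m → Disjoint u v →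
        segWeight m u < segWeight m v → ReplaceClosed u v A' := by
  classical
  set S : Finset (Finset (Finset ℕ) × Finset (Finset ℕ)) :=
    ((Finset.range m).powerset.powerset ×ˢ (Finset.range m).powerset.powerset).filter
      fun p => Separated p.1 p.2 ∧ p.1.card = A.card ∧ p.2.card = B.card with hS
  have hmem : ∀ p, p ∈ S ↔ (p.1 ⊆ (Finset.range m).powerset ∧ p.2 ⊆ (Finset.range m).powerset) ∧
      Separated p.1 p.2 ∧ p.1.card = A.card ∧ p.2.card = B.card := by
    intro p
    simp only [hS, Finset.mem_filter, Finset.mem_product, Finset.mem_powerset]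
  obtain ⟨⟨A', B'⟩, hp, hmin⟩ := S.exists_min_image
    (fun p => ∑ a ∈ p.1, segWeight m a - ∑ b ∈ p.2, segWeight m b)
    ⟨(A, B), (hmem _).2 ⟨⟨hA, hB⟩, hAB, rfl, rfl⟩⟩
  obtain ⟨⟨hA', hB'⟩, hsep, hcA, hcB⟩ := (hmem _).1 hp
  simp only at hA' hB' hsep hcA hcB hmin
  refine ⟨A', B', hA', hB', hsep, hcA, hcB, ?_⟩
  -- The opposite closure of `B'` is carried along because preserving separation uses both.
  suffices H : ∀ N : ℕ, ∀ u v : Finset ℕ, u.card + v.card = N → u ⊆ Finset.range m →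
      v ⊆ Finset.range m → Disjoint u v → segWeight m u < segWeight m v →
      ReplaceClosed u v A' ∧ ReplaceClosed v u B' by
    intro u v hu hv huv hlt
    exact (H _ u v rfl hu hv huv hlt).1
  intro N
  induction N using Nat.strong_induction_on with
  | _ N ih =>
    intro u v hN hu hv huv hlt
    have hues : ∀ x, u.erase x ⊆ u := fun x => Finset.erase_subset _ _
    have hves : ∀ x, v.erase x ⊆ v := fun x => Finset.erase_subset _ _
    have hcu : ∀ x ∈ u, (u.erase x).card + 1 = u.card := fun x hx => Finset.card_erase_add_one hx
    have hcv : ∀ x ∈ v, (v.erase x).card + 1 = v.card := fun x hx => Finset.card_erase_add_one hx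
    have hx : ∀ x ∈ u, ReplaceClosed (u.erase x) v A' ∧ ReplaceClosed v (u.erase x) B' := by
      intro x hx
      refine ih _ ?_ (u.erase x) v rfl ((hues x).trans hu) hv (huv.mono_left (hues x))
        ((segWeight_erase_lt hu hx).trans hlt)
      have := hcu x hx
      omega
    have hy : ∀ x ∈ v, (ReplaceClosed u (v.erase x) A' ∧ ReplaceClosed (v.erase x) u B') ∨
        ∃ y ∈ u, ReplaceClosed (u.erase y) (v.erase x) A' ∧
          ReplaceClosed (v.erase x) (u.erase y) B' := by
      intro x hxv
      rcases u.eq_empty_or_nonempty with rfl | hne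
      · left
        rcases (v.erase x).eq_empty_or_nonempty with hv0 | hv0
        · rw [hv0]
          exact ⟨replaceClosed_empty _, replaceClosed_empty _⟩
        · refine ih _ ?_ ∅ (v.erase x) rfl hu ((hves x).trans hv) (huv.mono_right (hves x)) ?_
          · have := hcv x hxv
            omega
          · rw [segWeight_lt_iff hu ((hves x).trans hv)]
            left
            simpa using hv0.card_pos
      · right
        obtain ⟨y, hyu, hy⟩ := exists_segWeight_erase hu hv huv hlt hxv hne
        refine ⟨y, hyu, ?_⟩
        rcases hy with hy | ⟨h1, h2⟩
        · refine ih _ ?_ (u.erase y) (v.erase x) rfl ((hues y).trans hu) ((hves x).trans hv)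
            (huv.mono (hues y) (hves x)) hy
          have := hcv x hxv
          have := hcu y hyu
          omega
        · rw [h1, h2]
          exact ⟨replaceClosed_empty _, replaceClosed_empty _⟩
    have hnew : (UV.compression u v A', UV.compression v u B') ∈ S := by
      refine (hmem _).2 ⟨⟨compression_subset_powerset hu hA', compression_subset_powerset hv hB'⟩,
        ?_, ?_, ?_⟩
      · refine hsep.compression huv (fun x h => Or.inl (hx x h).1) ?_
          (fun x h => Or.inl (hx x h).2) ?_
        · intro x h
          rcases hy x h with h1 | ⟨y, h1, h2⟩
          · exact Or.inl h1.1
          · exact Or.inr ⟨y, h1, h2.1⟩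
        · intro x h
          rcases hy x h with h1 | ⟨y, h1, h2⟩
          · exact Or.inl h1.2
          · exact Or.inr ⟨y, h1, h2.2⟩
      · rw [UV.card_compression]; exact hcA
      · rw [UV.card_compression]; exact hcB
    have hle := hmin _ hnew
    simp only [sum_segWeight_compression] at hle
    set n₁ := (A'.filter fun a => UV.compress u v a ∉ A').card with hn₁
    set n₂ := (B'.filter fun a => UV.compress v u a ∉ B').card with hn₂
    have hpos : ((n₁ : ℤ) + n₂) * (segWeight m v - segWeight m u) ≤ 0 := by linarith
    have hsum : (n₁ : ℤ) + n₂ ≤ 0 := by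
      by_contra! h
      have := mul_pos h (sub_pos.2 hlt)
      linarith
    exact ⟨replaceClosed_of_card_eq_zero (by omega), replaceClosed_of_card_eq_zero (by omega)⟩

/-- Families closed under all replacements by earlier sets are initial segments. -/
lemma mem_of_segWeight_lt {m : ℕ} {A : Finset (Finset ℕ)} (hA : A ⊆ (Finset.range m).powerset)
    (h : ∀ u v : Finset ℕ, u ⊆ Finset.range m → v ⊆ Finset.range m → Disjoint u v →
      segWeight m u < segWeight m v → ReplaceClosed u v A) {a b : Finset ℕ} (ha : a ∈ A)
    (hb : b ⊆ Finset.range m) (hlt : segWeight m b < segWeight m a) : b ∈ A := by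
  have har := Finset.mem_powerset.1 (hA ha)
  -- Cancelling `a ∩ b` turns the comparison of `b` with `a` into one of disjoint sets, by
  -- additivity of the weight.
  have hba : (a ∪ b \ a) \ (a \ b) = b := by
    ext z
    by_cases z ∈ a <;> by_cases z ∈ b <;> simp_all
  have h1 := segWeight_replace (m := m) (u := b \ a) (v := a \ b) (a := a)
    Finset.sdiff_disjoint Finset.sdiff_subset
  rw [hba] at h1
  have h2 := h (b \ a) (a \ b) (Finset.sdiff_subset.trans hb) (Finset.sdiff_subset.trans har)
    (disjoint_sdiff_sdiff) (by linarith) a ha Finset.sdiff_disjoint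
    Finset.sdiff_subset
  rwa [hba] at h2

lemma eq_of_initial_segments {m : ℕ} {A P : Finset (Finset ℕ)}
    (hA : A ⊆ (Finset.range m).powerset) (hP : P ⊆ (Finset.range m).powerset)
    (hA' : ∀ a ∈ A, ∀ b ⊆ Finset.range m, segWeight m b < segWeight m a → b ∈ A)
    (hP' : ∀ a ∈ P, ∀ b ⊆ Finset.range m, segWeight m b < segWeight m a → b ∈ P)
    (hcard : A.card = P.card) : A = P := by
  by_contra hne
  have h1 : ¬ A ⊆ P := fun h => hne (Finset.eq_of_subset_of_card_le h hcard.ge)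
  have h2 : ¬ P ⊆ A := fun h => hne (Finset.eq_of_subset_of_card_le h hcard.le).symm
  obtain ⟨a, haA, haP⟩ := Finset.not_subset.1 h1
  obtain ⟨p, hpP, hpA⟩ := Finset.not_subset.1 h2
  have har := Finset.mem_powerset.1 (hA haA)
  have hpr := Finset.mem_powerset.1 (hP hpP)
  rcases lt_trichotomy (segWeight m a) (segWeight m p) with h | h | h
  · exact haP (hP' p hpP a har h)
  · exact haP (segWeight_injOn har hpr h ▸ hpP)
  · exact hpA (hA' a haA p hpr h)

/-! ### The extremal initial segment and Harper's inequality -/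

/-- The sum of the first `m` central binomial coefficients. -/
def centralSum (m : ℕ) : ℕ := ∑ j ∈ Finset.range m, Nat.choose j (j / 2)

lemma centralSum_succ (m : ℕ) : centralSum (m + 1) = centralSum m + Nat.choose m (m / 2) :=
  Finset.sum_range_succ _ _

/-- The subsets of `{0, …, m - 1}` with fewer than `w` elements. -/
def smallSets (m w : ℕ) : Finset (Finset ℕ) := {a ∈ (Finset.range m).powerset | a.card < w}

lemma mem_smallSets {m w : ℕ} {a : Finset ℕ} :
    a ∈ smallSets m w ↔ a ⊆ Finset.range m ∧ a.card < w := by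
  simp [smallSets]

lemma card_largeSets {m w : ℕ} (hw : w ≤ m) :
    ({a ∈ (Finset.range m).powerset | m - w < a.card} : Finset (Finset ℕ)).card =
      (smallSets m w).card := by
  refine Finset.card_nbij' (fun a => Finset.range m \ a) (fun a => Finset.range m \ a) ?_ ?_ ?_ ?_
  · intro a ha
    simp only [Finset.mem_coe, Finset.mem_filter, Finset.mem_powerset] at ha
    have := Finset.card_sdiff_of_subset ha.1
    have := Finset.card_le_card ha.1
    rw [Finset.card_range] at *
    rw [Finset.mem_coe, mem_smallSets]
    refine ⟨Finset.sdiff_subset, ?_⟩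
    change (Finset.range m \ a).card < w
    omega
  · intro a ha
    rw [Finset.mem_coe, mem_smallSets] at ha
    have := Finset.card_sdiff_of_subset ha.1
    have := Finset.card_le_card ha.1
    rw [Finset.card_range] at *
    simp only [Finset.mem_coe, Finset.mem_filter, Finset.mem_powerset]
    exact ⟨Finset.sdiff_subset, by omega⟩
  · intro a ha
    simp only [Finset.mem_coe, Finset.mem_filter, Finset.mem_powerset] at ha
    exact Finset.sdiff_sdiff_eq_self ha.1
  · intro a ha
    rw [Finset.mem_coe, mem_smallSets] at ha
    exact Finset.sdiff_sdiff_eq_self ha.1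

lemma card_layers (m w : ℕ) :
    (smallSets m w).card + Nat.choose m w +
      ({a ∈ (Finset.range m).powerset | w < a.card} : Finset (Finset ℕ)).card = 2 ^ m := by
  have h1 := Finset.card_filter_add_card_filter_not (s := (Finset.range m).powerset)
    (fun a => a.card < w)
  have h2 := Finset.card_filter_add_card_filter_not
    (s := {a ∈ (Finset.range m).powerset | ¬ a.card < w}) (fun a => a.card = w)
  rw [Finset.filter_filter, Finset.filter_filter] at h2
  have h3 : ({a ∈ (Finset.range m).powerset | ¬ a.card < w ∧ a.card = w} : Finset _) =
      (Finset.range m).powersetCard w := by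
    rw [Finset.powersetCard_eq_filter]
    refine Finset.filter_congr fun a _ => ?_
    omega
  have h4 : ({a ∈ (Finset.range m).powerset | ¬ a.card < w ∧ ¬ a.card = w} : Finset _) =
      {a ∈ (Finset.range m).powerset | w < a.card} := by
    refine Finset.filter_congr fun a _ => ?_
    omega
  rw [h3, h4, Finset.card_powersetCard, Finset.card_range] at h2
  rw [Finset.card_powerset, Finset.card_range] at h1
  rw [smallSets]
  omega

/-- A nonempty set of size at most `w` loses an element to land in the ball, so members of `B` have
more than `w` elements and the whole layer `w` is missed. -/
lemma card_add_card_smallSets_le {m w : ℕ} (hw : 1 ≤ w) {B : Finset (Finset ℕ)}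
    (hB : B ⊆ (Finset.range m).powerset) (h : Separated (smallSets m w) B) :
    B.card + (smallSets m w).card + Nat.choose m w ≤ 2 ^ m := by
  have h1 : B ⊆ {a ∈ (Finset.range m).powerset | w < a.card} := by
    intro b hb
    have hbr := Finset.mem_powerset.1 (hB hb)
    refine Finset.mem_filter.2 ⟨hB hb, ?_⟩
    by_contra! hle
    rcases b.eq_empty_or_nonempty with rfl | ⟨x, hx⟩
    · have := h ∅ (mem_smallSets.2 ⟨by simp, by rw [Finset.card_empty]; omega⟩) ∅ hb
      simp at this
    · have h2 := h (b.erase x) (mem_smallSets.2 ⟨(Finset.erase_subset _ _).trans hbr, by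
        have := Finset.card_erase_add_one hx
        omega⟩) b hb
      have h3 : (b.erase x) ∆ b ⊆ {x} := by
        intro z hz
        simp only [Finset.mem_symmDiff, Finset.mem_erase, Finset.mem_singleton] at hz ⊢
        tauto
      have h4 := Finset.card_le_card h3
      rw [Finset.card_singleton] at h4
      omega
  have := Finset.card_le_card h1
  have := card_layers m w
  omega

/-- The family on `{0, …, m}` whose members without `m` are `X` and whose members with `m` are
those of `Y` with `m` added. -/
def glue (m : ℕ) (X Y : Finset (Finset ℕ)) : Finset (Finset ℕ) := X ∪ Y.image (insert m)

section glue

variable {m : ℕ} {X Y : Finset (Finset ℕ)}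

lemma notMem_of_mem_powerset {B : Finset (Finset ℕ)} (hB : B ⊆ (Finset.range m).powerset)
    {b : Finset ℕ} (hb : b ∈ B) : m ∉ b := by
  intro h
  have := Finset.mem_powerset.1 (hB hb) h
  simp at this

lemma mem_glue (hX : X ⊆ (Finset.range m).powerset) (hY : Y ⊆ (Finset.range m).powerset)
    {a : Finset ℕ} : a ∈ glue m X Y ↔ (m ∉ a ∧ a ∈ X) ∨ (m ∈ a ∧ a.erase m ∈ Y) := by
  rw [glue, Finset.mem_union, Finset.mem_image]
  constructor
  · rintro (h | ⟨y, hy, rfl⟩)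
    · exact Or.inl ⟨notMem_of_mem_powerset hX h, h⟩
    · exact Or.inr ⟨Finset.mem_insert_self _ _, by
        rwa [Finset.erase_insert (notMem_of_mem_powerset hY hy)]⟩
  · rintro (⟨-, h⟩ | ⟨h1, h2⟩)
    · exact Or.inl h
    · exact Or.inr ⟨_, h2, Finset.insert_erase h1⟩

lemma card_glue (hX : X ⊆ (Finset.range m).powerset) (hY : Y ⊆ (Finset.range m).powerset) :
    (glue m X Y).card = X.card + Y.card := by
  rw [glue, Finset.card_union_of_disjoint, Finset.card_image_of_injOn]
  · intro a ha b hb hab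
    have := congrArg (fun s => s.erase m) hab
    simpa [Finset.erase_insert (notMem_of_mem_powerset hY ha),
      Finset.erase_insert (notMem_of_mem_powerset hY hb)] using this
  · rw [Finset.disjoint_left]
    intro a ha hb
    obtain ⟨y, -, rfl⟩ := Finset.mem_image.1 hb
    exact notMem_of_mem_powerset hX ha (Finset.mem_insert_self _ _)

lemma glue_subset (hX : X ⊆ (Finset.range m).powerset) (hY : Y ⊆ (Finset.range m).powerset) :
    glue m X Y ⊆ (Finset.range (m + 1)).powerset := by
  intro a ha
  rw [Finset.mem_powerset, Finset.range_add_one]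
  rcases (mem_glue hX hY).1 ha with ⟨-, h⟩ | ⟨h1, h2⟩
  · exact (Finset.mem_powerset.1 (hX h)).trans (Finset.subset_insert _ _)
  · rw [← Finset.insert_erase h1]
    exact Finset.insert_subset_insert _ (Finset.mem_powerset.1 (hY h2))

lemma exists_eq_glue {B : Finset (Finset ℕ)} (hB : B ⊆ (Finset.range (m + 1)).powerset) :
    ∃ X Y : Finset (Finset ℕ), X ⊆ (Finset.range m).powerset ∧ Y ⊆ (Finset.range m).powerset ∧
      B = glue m X Y := by
  have hX : {b ∈ B | m ∉ b} ⊆ (Finset.range m).powerset := by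
    intro b hb
    obtain ⟨h1, h2⟩ := Finset.mem_filter.1 hb
    have := Finset.mem_powerset.1 (hB h1)
    rw [Finset.range_add_one] at this
    exact Finset.mem_powerset.2 ((Finset.subset_insert_iff_of_notMem h2).1 this)
  have hY : {b ∈ B | m ∈ b}.image (fun b => b.erase m) ⊆ (Finset.range m).powerset := by
    intro b hb
    obtain ⟨b', hb', rfl⟩ := Finset.mem_image.1 hb
    have := Finset.mem_powerset.1 (hB (Finset.mem_filter.1 hb').1)
    rw [Finset.range_add_one] at this
    exact Finset.mem_powerset.2 (Finset.subset_insert_iff.1 this)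
  refine ⟨_, _, hX, hY, ?_⟩
  ext b
  rw [mem_glue hX hY]
  by_cases hm : m ∈ b
  · simp only [hm, not_true, false_and, true_and, false_or, Finset.mem_image, Finset.mem_filter]
    constructor
    · intro h
      exact ⟨b, ⟨h, hm⟩, rfl⟩
    · rintro ⟨b', ⟨h1, h2⟩, h3⟩
      rw [← Finset.insert_erase h2, h3, Finset.insert_erase hm] at h1
      exact h1
  · simp [hm]

lemma Separated.of_glue {X' Y' : Finset (Finset ℕ)} (hY : Y ⊆ (Finset.range m).powerset)
    (hY' : Y' ⊆ (Finset.range m).powerset) (h : Separated (glue m X Y) (glue m X' Y')) :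
    Separated X X' ∧ Separated Y Y' := by
  constructor
  · intro a ha b hb
    exact h a (Finset.mem_union_left _ ha) b (Finset.mem_union_left _ hb)
  · intro a ha b hb
    have h1 := h _ (Finset.mem_union_right _ (Finset.mem_image_of_mem _ ha)) _
      (Finset.mem_union_right _ (Finset.mem_image_of_mem _ hb))
    have h2 : insert m a ∆ insert m b = a ∆ b := by
      have h3 := notMem_of_mem_powerset hY ha
      have h4 := notMem_of_mem_powerset hY' hb
      ext z
      simp only [Finset.mem_symmDiff, Finset.mem_insert]
      by_cases hz : z = m
      · subst hz; simp [h3, h4]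
      · simp [hz]
    rwa [h2] at h1

end glue

lemma smallSets_subset (m w : ℕ) : smallSets m w ⊆ (Finset.range m).powerset :=
  Finset.filter_subset _ _

/-- An initial segment of the simplicial order with the largest possible vertex boundary. -/
def peakFamily : ℕ → Finset (Finset ℕ)
  | 0 => {∅}
  | m + 1 => if m % 2 = 1 then glue m (smallSets m ((m + 1) / 2)) (peakFamily m)
      else glue m (peakFamily m) (smallSets m (m / 2))

lemma peakFamily_subset (m : ℕ) : peakFamily m ⊆ (Finset.range m).powerset := by
  induction m with
  | zero => simp [peakFamily]
  | succ m ih =>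
    rw [peakFamily]
    split_ifs
    · exact glue_subset (smallSets_subset _ _) ih
    · exact glue_subset ih (smallSets_subset _ _)

lemma card_peakFamily_succ (m : ℕ) : (peakFamily (m + 1)).card =
    (peakFamily m).card + (smallSets m ((m + 1) / 2)).card := by
  rw [peakFamily]
  split_ifs with h
  · rw [card_glue (smallSets_subset _ _) (peakFamily_subset m), add_comm]
  · rw [card_glue (peakFamily_subset m) (smallSets_subset _ _),
      show (m + 1) / 2 = m / 2 by omega]

/-- Complementation matches the small sets with equally many large ones; only for even `m` is a
middle layer left over. -/
lemma two_mul_card_smallSets (m : ℕ) :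
    2 ^ m ≤ 2 * (smallSets m ((m + 1) / 2)).card + Nat.choose m (m / 2) ∧
      2 * (smallSets m ((m + 1) / 2)).card ≤ 2 ^ m := by
  rcases Nat.even_or_odd' m with ⟨w, rfl | rfl⟩
  · rw [show (2 * w + 1) / 2 = w by omega, show 2 * w / 2 = w by omega]
    have h1 := card_layers (2 * w) w
    have h2 := card_largeSets (m := 2 * w) (w := w) (by omega)
    rw [show 2 * w - w = w by omega] at h2
    omega
  · rw [show (2 * w + 1 + 1) / 2 = w + 1 by omega, show (2 * w + 1) / 2 = w by omega]
    have h2 := card_largeSets (m := 2 * w + 1) (w := w + 1) (by omega)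
    rw [show 2 * w + 1 - (w + 1) = w by omega] at h2
    have h3 := Finset.card_filter_add_card_filter_not (s := (Finset.range (2 * w + 1)).powerset)
      (fun a => w < a.card)
    have h4 : ({a ∈ (Finset.range (2 * w + 1)).powerset | ¬ w < a.card} : Finset _) =
        smallSets (2 * w + 1) (w + 1) :=
      Finset.filter_congr fun a _ => by omega
    rw [h4, Finset.card_powerset, Finset.card_range] at h3
    omega

/-- With s this size, the window argument needs 2s and 2(k - s) to be at most `2 ^ m + 2`; these
bounds supply both. -/
lemma card_peakFamily_bounds (m : ℕ) :
    2 ^ m ≤ 2 * (peakFamily m).card + centralSum m ∧ 2 * (peakFamily m).card ≤ 2 ^ m + 1 := by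
  induction m with
  | zero => simp [peakFamily, centralSum]
  | succ m ih =>
    have := two_mul_card_smallSets m
    rw [card_peakFamily_succ, centralSum_succ, pow_succ]
    omega

lemma sum_two_pow_erase {m : ℕ} {a : Finset ℕ} (h : m ∈ a) :
    ∑ i ∈ a.erase m, 2 ^ i + 2 ^ m = ∑ i ∈ a, 2 ^ i :=
  Finset.sum_erase_add _ _ h

/-- The first two clauses strengthen the induction: they settle comparisons between a set containing
`m` and one that does not, which lie in different halves of the gluing. -/
lemma peakFamily_initial (m : ℕ) :
    (∀ a ∈ peakFamily m, a.card ≤ m / 2) ∧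
    (∀ a ⊆ Finset.range m, a.card < m / 2 → a ∈ peakFamily m) ∧
    ∀ a ∈ peakFamily m, ∀ b ⊆ Finset.range m,
      (b.card < a.card ∨ b.card = a.card ∧ ∑ i ∈ a, 2 ^ i < ∑ i ∈ b, 2 ^ i) →
      b ∈ peakFamily m := by
  induction m with
  | zero =>
    simp [peakFamily]
  | succ m ih =>
    obtain ⟨ih1, ih2, ih3⟩ := ih
    have hsub : ∀ b ⊆ Finset.range (m + 1), b.erase m ⊆ Finset.range m := by
      intro b hb
      rw [Finset.range_add_one] at hb
      exact Finset.subset_insert_iff.1 hb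
    have hsub' : ∀ b ⊆ Finset.range (m + 1), m ∉ b → b ⊆ Finset.range m := by
      intro b hb hm
      have := hsub b hb
      rwa [Finset.erase_eq_of_notMem hm] at this
    have hce : ∀ b : Finset ℕ, m ∈ b → (b.erase m).card + 1 = b.card :=
      fun b hb => Finset.card_erase_add_one hb
    have hpow : ∀ b ⊆ Finset.range (m + 1), m ∉ b → ∑ i ∈ b, 2 ^ i < 2 ^ m :=
      fun b hb hm => sum_two_pow_lt (hsub' b hb hm)
    have hsum : ∀ b : Finset ℕ, m ∈ b → ∑ i ∈ b.erase m, 2 ^ i + 2 ^ m = ∑ i ∈ b, 2 ^ i :=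
      fun b hb => sum_two_pow_erase hb
    have hPs := peakFamily_subset (m + 1)
    rw [peakFamily] at hPs ⊢
    split_ifs at hPs ⊢ with hodd
    · simp only [mem_glue (smallSets_subset m ((m + 1) / 2)) (peakFamily_subset m)] at hPs ⊢
      refine ⟨?_, ?_, ?_⟩
      · rintro a (⟨h1, h2⟩ | ⟨h1, h2⟩)
        · exact (mem_smallSets.1 h2).2.le
        · have := ih1 _ h2
          have := hce a h1
          omega
      · intro a ha hcard
        by_cases hm : m ∈ a
        · have := hce a hm
          exact Or.inr ⟨hm, ih2 _ (hsub a ha) (by omega)⟩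
        · exact Or.inl ⟨hm, mem_smallSets.2 ⟨hsub' a ha hm, hcard⟩⟩
      · rintro a (⟨h1, h2⟩ | ⟨h1, h2⟩) b hb hab
        · have := (mem_smallSets.1 h2).2
          by_cases hm : m ∈ b
          · have := hce b hm
            exact Or.inr ⟨hm, ih2 _ (hsub b hb) (by omega)⟩
          · exact Or.inl ⟨hm, mem_smallSets.2 ⟨hsub' b hb hm, by omega⟩⟩
        · have h3 := ih1 _ h2
          have h4 := hce a h1
          have h5 := hsum a h1
          by_cases hm : m ∈ b
          · have h6 := hce b hm
            have h7 := hsum b hm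
            exact Or.inr ⟨hm, ih3 _ h2 _ (hsub b hb) (by omega)⟩
          · have := hpow b hb hm
            exact Or.inl ⟨hm, mem_smallSets.2 ⟨hsub' b hb hm, by omega⟩⟩
    · simp only [mem_glue (peakFamily_subset m) (smallSets_subset m (m / 2))] at hPs ⊢
      refine ⟨?_, ?_, ?_⟩
      · rintro a (⟨h1, h2⟩ | ⟨h1, h2⟩)
        · have := ih1 _ h2
          omega
        · have := (mem_smallSets.1 h2).2
          have := hce a h1
          omega
      · intro a ha hcard
        by_cases hm : m ∈ a
        · have := hce a hm
          exact Or.inr ⟨hm, mem_smallSets.2 ⟨hsub a ha, by omega⟩⟩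
        · exact Or.inl ⟨hm, ih2 _ (hsub' a ha hm) (by omega)⟩
      · rintro a (⟨h1, h2⟩ | ⟨h1, h2⟩) b hb hab
        · have h3 := ih1 _ h2
          by_cases hm : m ∈ b
          · have h6 := hce b hm
            exact Or.inr ⟨hm, mem_smallSets.2 ⟨hsub b hb, by omega⟩⟩
          · exact Or.inl ⟨hm, ih3 _ h2 _ (hsub' b hb hm) hab⟩
        · have h3 := (mem_smallSets.1 h2).2
          have h4 := hce a h1
          have h5 := hsum a h1
          by_cases hm : m ∈ b
          · have h6 := hce b hm
            exact Or.inr ⟨hm, mem_smallSets.2 ⟨hsub b hb, by omega⟩⟩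
          · have := hpow b hb hm
            exact Or.inl ⟨hm, ih2 _ (hsub' b hb hm) (by omega)⟩

/-- One half of the family is a Hamming ball bounded by a middle layer, of size `choose m (m / 2)`;
the other half is the preceding peak family. Separation restricts to the halves, so the numbers of
missed sets add up. -/
lemma card_add_card_peakFamily_le (m : ℕ) : ∀ B ⊆ (Finset.range m).powerset,
    Separated (peakFamily m) B → B.card + (peakFamily m).card + centralSum m ≤ 2 ^ m := by
  induction m with
  | zero =>
    intro B hB h
    have hB0 : B = ∅ := by
      rw [Finset.eq_empty_iff_forall_notMem]
      intro b hb
      have h1 := Finset.mem_powerset.1 (hB hb)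
      have h2 := h ∅ (by simp [peakFamily]) b hb
      simp at h1
      simp [h1] at h2
    simp [hB0, peakFamily, centralSum]
  | succ m ih =>
    intro B hB h
    -- For `m = 0` the ball is empty and the bound for balls does not apply.
    rcases Nat.eq_zero_or_pos m with rfl | hm
    · have hB0 : B = ∅ := by
        rw [Finset.eq_empty_iff_forall_notMem]
        intro b hb
        have h1 := Finset.card_le_card (Finset.mem_powerset.1 (hB hb))
        have h2 := h ∅ (by simp [peakFamily, glue]) b hb
        have h3 : (∅ : Finset ℕ) ∆ b = b := bot_symmDiff b
        rw [h3] at h2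
        simp at h1
        omega
      simp [hB0, peakFamily, centralSum, glue, smallSets]
    · obtain ⟨X, Y, hX, hY, rfl⟩ := exists_eq_glue hB
      rw [card_peakFamily_succ, centralSum_succ, card_glue hX hY, pow_succ]
      rw [peakFamily] at h
      split_ifs at h with hodd
      · obtain ⟨h1, h2⟩ := h.of_glue (peakFamily_subset m) hY
        have h3 := ih Y hY h2
        have h4 := card_add_card_smallSets_le (by omega) hX h1
        have h5 : Nat.choose m ((m + 1) / 2) = Nat.choose m (m / 2) :=
          Nat.choose_symm_of_eq_add (by omega)
        omega
      · obtain ⟨h1, h2⟩ := h.of_glue (smallSets_subset m (m / 2)) hY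
        have h3 := ih X hX h1
        have h4 := card_add_card_smallSets_le (by omega) hY h2
        rw [show (m + 1) / 2 = m / 2 by omega]
        omega

/-- Harper's vertex isoperimetric inequality at the size of `peakFamily m`. -/
theorem card_add_card_le_of_separated {m : ℕ} {A B : Finset (Finset ℕ)}
    (hA : A ⊆ (Finset.range m).powerset) (hB : B ⊆ (Finset.range m).powerset)
    (hAB : Separated A B) (hcard : A.card = (peakFamily m).card) :
    A.card + B.card + centralSum m ≤ 2 ^ m := by
  obtain ⟨A', B', hA', hB', hsep, hcA, hcB, hclosed⟩ := exists_separated_replaceClosed hA hB hAB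
  have heq : A' = peakFamily m := by
    refine eq_of_initial_segments hA' (peakFamily_subset m)
      (fun a ha b hb => mem_of_segWeight_lt hA' hclosed ha hb) ?_ (hcA.trans hcard)
    intro a ha b hb hlt
    rw [segWeight_lt_iff hb (Finset.mem_powerset.1 (peakFamily_subset m ha))] at hlt
    exact (peakFamily_initial m).2.2 a ha b hb hlt
  subst heq
  have := card_add_card_peakFamily_le m B' hB' hsep
  omega

/-! ### Windows in balanced sequences -/

/-- An intermediate value lemma for integer sequences with steps at least `-1`. -/
lemma exists_eq_of_steps {f : ℕ → ℤ} {a b : ℕ} {v : ℤ} (hab : a ≤ b)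
    (hstep : ∀ x, a ≤ x → x < b → f (x + 1) ≤ f x + 1) (ha : f a ≤ v) (hb : v ≤ f b) :
    ∃ x, a ≤ x ∧ x ≤ b ∧ f x = v := by
  induction b, hab using Nat.le_induction with
  | base => exact ⟨a, le_rfl, le_rfl, le_antisymm ha hb⟩
  | succ b hab ih =>
    by_cases h : v ≤ f b
    · obtain ⟨x, h1, h2, h3⟩ := ih (fun x h1 h2 => hstep x h1 (by omega)) h
      exact ⟨x, h1, by omega, h3⟩
    · have := hstep b hab (by omega)
      exact ⟨b + 1, by omega, le_rfl, by omega⟩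

/-- `E x` and `O x` count the entries of two kinds among the first `x` entries of a sequence of
length `2 * M`, each kind occurring `M` times. -/
structure BalancedCounts (M : ℕ) (E O : ℕ → ℤ) : Prop where
  monoE : Monotone E
  monoO : Monotone O
  nonnegE : 0 ≤ E 0
  nonnegO : 0 ≤ O 0
  add : ∀ x ≤ 2 * M, E x + O x = x
  topE : E (2 * M) = M
  topO : O (2 * M) = M

/-- There are no concentric windows of total length `2 * k`, the inner one holding `p` entries of
the first kind and the outer one holding `q` entries of the second kind. -/
def WindowFree (M k : ℕ) (p q : ℤ) (E O : ℕ → ℤ) : Prop :=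
  ∀ i j : ℕ, i ≤ j → j ≤ i + k → j + k ≤ 2 * M → E (i + k) = E j + p → O (j + k) < O i + q

namespace BalancedCounts

variable {M : ℕ} {E O : ℕ → ℤ}

lemma swap (h : BalancedCounts M E O) : BalancedCounts M O E :=
  ⟨h.monoO, h.monoE, h.nonnegO, h.nonnegE, fun x hx => by rw [add_comm]; exact h.add x hx,
    h.topO, h.topE⟩

lemma stepE (h : BalancedCounts M E O) {x : ℕ} (hx : x + 1 ≤ 2 * M) : E (x + 1) ≤ E x + 1 := by
  have h1 := h.add (x + 1) hx
  have h2 := h.add x (by omega)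
  have h3 := h.monoO (Nat.le_succ x)
  simp only [Nat.succ_eq_add_one] at h3
  push_cast at h1
  omega

lemma zero (h : BalancedCounts M E O) : E 0 = 0 ∧ O 0 = 0 := by
  have h1 := h.add 0 (by omega)
  have := h.nonnegE
  have := h.nonnegO
  push_cast at h1
  omega

/-- If all windows of length `k` hold more than `p` entries of the first kind, `q ≤ p`, then there
is a forbidden pair of windows. -/
lemma false_of_all_gt (h : BalancedCounts M E O) {k : ℕ} {p q : ℤ} (hk : k ≤ M) (hp : 0 < p)
    (hpq : p + q = k) (hqp : q ≤ p + 1) (hf : WindowFree M k p q E O)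
    (hall : ∀ x, x + k ≤ 2 * M → E x + p < E (x + k)) : False := by
  -- Put φ x = E x - O (x + k). By `add`, E (x + k) - O x = φ x + k, so `hf` says φ i < φ j for each
  -- pair it applies to. Hence the minimum point `y` cannot serve as `j`.
  obtain ⟨y, hy, hmin⟩ := (Finset.range (2 * M - k + 1)).exists_min_image
    (fun x => E x - O (x + k)) ⟨0, by simp⟩
  rw [Finset.mem_range] at hy
  have hEy : E y + p < E k := by
    by_contra! hle
    obtain ⟨x, -, hxy, hx⟩ := exists_eq_of_steps (f := fun x => E (x + k)) (Nat.zero_le y)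
      (v := E y + p) (fun x _ hx => by
        have := h.stepE (x := x + k) (by omega)
        rwa [show x + k + 1 = x + 1 + k by omega] at this)
      (by simpa using hle) (hall y (by omega)).le
    have hyx : y ≤ x + k := by
      by_contra! hlt
      have := h.monoE hlt.le
      omega
    have h1 := hf x y hxy hyx (by omega) hx
    have h2 := hmin x (Finset.mem_range.2 (by omega))
    have h3 := h.add x (by omega)
    have h4 := h.add (x + k) (by omega)
    push_cast at h4
    omega
  have hyk : y ≤ k := by
    by_contra! hlt
    have := h.monoE hlt.le
    omega
  obtain ⟨x, hyx, hxk, hx⟩ := exists_eq_of_steps (f := E) hyk (v := E k - p)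
    (fun x _ hx => h.stepE (by omega)) (by omega) (by omega)
  -- The pair starting at 0 gives O (y + k) < q, so the minimum of φ is at least 1 - q. The two
  -- windows filling the last 2k places give φ (2(M - k)) ≤ q - 2p - 3, which would force q ≥ p + 2.
  have h1 := hf 0 x (Nat.zero_le _) (by omega) (by omega) (by rw [zero_add]; omega)
  have h2 := h.monoO (show y + k ≤ x + k by omega)
  have h3 := hmin (2 * (M - k)) (Finset.mem_range.2 (by omega))
  have h4 := hall (2 * (M - k)) (by omega)
  have h5 := hall (2 * M - k) (by omega)
  rw [show 2 * (M - k) + k = 2 * M - k by omega] at h3 h4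
  rw [show 2 * M - k + k = 2 * M by omega, h.topE] at h5
  have h6 := h.add (2 * M - k) (by omega)
  have h7 := h.monoE (Nat.zero_le y)
  have h8 := h.zero
  push_cast [show k ≤ 2 * M by omega] at h6
  omega

/-- If all windows of length `k` hold between `q` and `p` entries of each kind, then the
difference count is maximal at a point preceded by few entries of the second kind. -/
lemma argmax_bounds (h : BalancedCounts M E O) {k : ℕ} {p q : ℤ} (hk : k ≤ M) (hq : 0 ≤ q)
    (hpq : p + q = k) (hf : WindowFree M k q p E O) (hf' : WindowFree M k q p O E)
    (hall : ∀ x, x + k ≤ 2 * M → E x + q < E (x + k))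
    (hall' : ∀ x, x + k ≤ 2 * M → O x + q < O (x + k)) :
    ∃ x, 2 * (M - k) < x ∧ x + k ≤ 2 * M ∧ O x + q + 2 ≤ p := by
  -- With the same φ, `hf` says φ i < φ j and the swapped `hf'` says φ j < φ i. So the maximum point
  -- `y` can be neither `i` in the first nor `j` in the second.
  obtain ⟨y, hy, hmax⟩ := (Finset.range (2 * M - k + 1)).exists_max_image
    (fun x => E x - O (x + k)) ⟨0, by simp⟩
  rw [Finset.mem_range] at hy
  have hyM := h.add y (by omega)
  have hykM := h.add (y + k) (by omega)
  push_cast at hykM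
  have hE : E (2 * M - k) + q < E (y + k) := by
    by_contra! hle
    have hend : E (y + k) ≤ E (min (2 * M - k) (y + k)) + q := by
      rcases le_total (2 * M - k) (y + k) with h1 | h1
      · rwa [min_eq_left h1]
      · rw [min_eq_right h1]; omega
    obtain ⟨x, hyx, hxm, hx⟩ := exists_eq_of_steps (f := E) (a := y)
      (b := min (2 * M - k) (y + k)) (v := E (y + k) - q) (by omega)
      (fun x _ hx => h.stepE (by omega)) (by have := hall y (by omega); omega) (by omega)
    have h1 := hf y x hyx (by omega) (by omega) (by omega)
    have h2 := hmax x (Finset.mem_range.2 (by omega))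
    omega
  have hyk : 2 * M - k < y + k := by
    by_contra! hle
    have := h.monoE hle
    omega
  have hO : O y + q < O k := by
    by_contra! hle
    -- If `y < k`, the truncated subtraction starts the search at 0, where the bound is `hle`
    -- itself.
    have hend : O (y - k + k) ≤ O y + q := by
      rcases le_total k y with h1 | h1
      · rw [Nat.sub_add_cancel h1]; omega
      · rw [Nat.sub_eq_zero_of_le h1, zero_add]; omega
    obtain ⟨x, hxk, hxy, hx⟩ := exists_eq_of_steps (f := fun x => O (x + k)) (a := y - k) (b := y)
      (v := O y + q) (by omega)
      (fun x _ hx => by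
        have := h.swap.stepE (x := x + k) (by omega)
        rwa [show x + k + 1 = x + 1 + k by omega] at this)
      hend (hall' y (by omega)).le
    have h1 := hf' x y hxy (by omega) (by omega) hx
    have h2 := hmax x (Finset.mem_range.2 (by omega))
    omega
  refine ⟨y, by omega, by omega, ?_⟩
  have h1 := h.add k (by omega)
  have h2 := hall 0 (by omega)
  rw [zero_add] at h2
  have := h.zero
  omega

/-- With i = j, no window of length k holds exactly p or q entries of the first kind. By discrete
continuity the counts are all above p, all below q, or all strictly between; the first two cases are
exchanged by swapping the kinds. -/
theorem false_of_windowFree (h : BalancedCounts M E O) {k : ℕ} {p q : ℤ} (hk : k ≤ M)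
    (hq : 0 < q) (hqp : q ≤ p) (hpq : p + q = k) (hc : p - q + k ≤ M + 2)
    (h1 : WindowFree M k p q E O) (h2 : WindowFree M k q p E O)
    (h3 : WindowFree M k p q O E) (h4 : WindowFree M k q p O E) : False := by
  have hne1 : ∀ x, x + k ≤ 2 * M → E (x + k) - E x ≠ p := by
    intro x hx he
    have h5 := h1 x x le_rfl (by omega) hx (by omega)
    have h6 := h.add x (by omega)
    have h7 := h.add (x + k) (by omega)
    push_cast at h7
    omega
  have hne2 : ∀ x, x + k ≤ 2 * M → E (x + k) - E x ≠ q := by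
    intro x hx he
    have h5 := h2 x x le_rfl (by omega) hx (by omega)
    have h6 := h.add x (by omega)
    have h7 := h.add (x + k) (by omega)
    push_cast at h7
    omega
  have hO : ∀ x, x + k ≤ 2 * M → O (x + k) - O x = k - (E (x + k) - E x) := by
    intro x hx
    have h6 := h.add x (by omega)
    have h7 := h.add (x + k) (by omega)
    push_cast at h7
    omega
  -- Sliding the window by one place changes its count by at most 1, so the count cannot jump over
  -- `v`.
  have hup : ∀ v : ℤ, (∀ x, x + k ≤ 2 * M → E (x + k) - E x ≠ v) → v < E (0 + k) - E 0 →
      ∀ x, x + k ≤ 2 * M → v < E (x + k) - E x := by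
    intro v hv h0 x
    induction x with
    | zero => intro _; exact h0
    | succ x ih =>
      intro hx
      have h5 := ih (by omega)
      have h6 := hv (x + 1) hx
      have h7 := h.stepE (x := x) (by omega)
      have h8 := h.monoE (show x + k ≤ x + 1 + k by omega)
      omega
  have hdown : ∀ v : ℤ, (∀ x, x + k ≤ 2 * M → E (x + k) - E x ≠ v) → E (0 + k) - E 0 < v →
      ∀ x, x + k ≤ 2 * M → E (x + k) - E x < v := by
    intro v hv h0 x
    induction x with
    | zero => intro _; exact h0
    | succ x ih =>
      intro hx
      have h5 := ih (by omega)
      have h6 := hv (x + 1) hx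
      have h7 := h.stepE (x := x + k) (by omega)
      have h8 := h.monoE (show x ≤ x + 1 by omega)
      rw [show x + k + 1 = x + 1 + k by omega] at h7
      omega
  have hne1' := hne1 0 (by omega)
  have hne2' := hne2 0 (by omega)
  rcases lt_or_gt_of_ne hne1' with ha | ha
  · rcases lt_or_gt_of_ne hne2' with hb | hb
    · refine h.swap.false_of_all_gt hk (by omega) hpq (by omega) h3 fun x hx => ?_
      have := hdown q hne2 hb x hx
      have := hO x hx
      omega
    · have hE' : ∀ x, x + k ≤ 2 * M → E x + q < E (x + k) := fun x hx => by
        have := hup q hne2 hb x hx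
        omega
      have hO' : ∀ x, x + k ≤ 2 * M → O x + q < O (x + k) := fun x hx => by
        have := hdown p hne1 ha x hx
        have := hO x hx
        omega
      obtain ⟨x, hx1, hx2, hx3⟩ := h.argmax_bounds hk hq.le hpq h2 h4 hE' hO'
      obtain ⟨y, hy1, hy2, hy3⟩ := h.swap.argmax_bounds hk hq.le hpq h4 h2 hO' hE'
      -- The smaller of the two positions exceeds 2(M - k) but is at most E y + O x ≤ 2(p - q) - 4,
      -- against `hc`.
      rcases le_total x y with hxy | hxy
      · have h5 := h.monoE hxy
        have h6 := h.add x (by omega)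
        omega
      · have h5 := h.monoO hxy
        have h6 := h.add y (by omega)
        omega
  · refine h.false_of_all_gt hk (by omega) hpq (by omega) h1 fun x hx => ?_
    have := hup p hne1 ha x hx
    omega

end BalancedCounts

/-! ### A ranking of the half cube with small jumps -/

/-- The position of a subset of `{0, …, m - 1}` among the subsets of its size, where the sets
containing the larger elements come first. -/
def layerRank : ℕ → Finset ℕ → ℕ
  | 0, _ => 0
  | m + 1, a => if m ∈ a then layerRank m (a.erase m)
      else (if a.card = 0 then 0 else Nat.choose m (a.card - 1)) + layerRank m a

lemma subset_range_of_notMem {m : ℕ} {a : Finset ℕ} (ha : a ⊆ Finset.range (m + 1)) (h : m ∉ a) :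
    a ⊆ Finset.range m := by
  rw [Finset.range_add_one] at ha
  exact (Finset.subset_insert_iff_of_notMem h).1 ha

lemma erase_subset_range {m : ℕ} {a : Finset ℕ} (ha : a ⊆ Finset.range (m + 1)) :
    a.erase m ⊆ Finset.range m := by
  rw [Finset.range_add_one] at ha
  exact Finset.subset_insert_iff.1 ha

lemma choose_succ_eq (m w : ℕ) : Nat.choose (m + 1) w =
    (if w = 0 then 0 else Nat.choose m (w - 1)) + Nat.choose m w := by
  cases w with
  | zero => simp
  | succ w => simp [Nat.choose_succ_succ]

lemma layerRank_lt (m : ℕ) : ∀ a ⊆ Finset.range m, layerRank m a < Nat.choose m a.card := by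
  induction m with
  | zero =>
    intro a ha
    have : a = ∅ := by simpa using ha
    simp [this, layerRank]
  | succ m ih =>
    intro a ha
    rw [layerRank, choose_succ_eq]
    split_ifs with h h0 h0
    · simp_all
    · have h1 := ih _ (erase_subset_range ha)
      rw [Finset.card_erase_of_mem h] at h1
      omega
    · have h1 := ih _ (subset_range_of_notMem ha h)
      omega
    · have h1 := ih _ (subset_range_of_notMem ha h)
      omega

lemma layerRank_injOn (m : ℕ) : ∀ a ⊆ Finset.range m, ∀ b ⊆ Finset.range m, a.card = b.card →
    layerRank m a = layerRank m b → a = b := by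
  induction m with
  | zero =>
    intro a ha b hb _ _
    have h1 : a = ∅ := by simpa using ha
    have h2 : b = ∅ := by simpa using hb
    rw [h1, h2]
  | succ m ih =>
    have haux : ∀ a ⊆ Finset.range (m + 1), ∀ b : Finset ℕ, m ∈ a →
        m ∉ b → a.card = b.card → layerRank (m + 1) a ≠ layerRank (m + 1) b := by
      intro a ha b h1 h2 hcard
      have h3 := layerRank_lt m _ (erase_subset_range ha)
      rw [Finset.card_erase_of_mem h1, hcard] at h3
      have h4 : b.card ≠ 0 := by
        rw [← hcard]
        exact (Finset.card_pos.2 ⟨m, h1⟩).ne'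
      rw [layerRank, layerRank, if_pos h1, if_neg h2, if_neg h4]
      omega
    intro a ha b hb hcard hr
    by_cases h1 : m ∈ a <;> by_cases h2 : m ∈ b
    · rw [layerRank, layerRank, if_pos h1, if_pos h2] at hr
      have := ih _ (erase_subset_range ha) _ (erase_subset_range hb)
        (by rw [Finset.card_erase_of_mem h1, Finset.card_erase_of_mem h2, hcard]) hr
      rw [← Finset.insert_erase h1, this, Finset.insert_erase h2]
    · exact absurd hr (haux a ha b h1 h2 hcard)
    · exact absurd hr.symm (haux b hb a h2 h1 hcard.symm)
    · rw [layerRank, layerRank, if_neg h1, if_neg h2, hcard] at hr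
      exact ih _ (subset_range_of_notMem ha h1) _ (subset_range_of_notMem hb h2) hcard (by omega)

/-- The left side minus `layerRank m a` is the jump in the whole ranking. By Pascal's rule, passing
from `m` to `m + 1` raises it by exactly `choose m a.card` when `x ≠ m`; when `x = m` that is the
entire jump. Each such term is at most the central coefficient. -/
lemma layerRank_insert_le (m : ℕ) : ∀ a ⊆ Finset.range m, ∀ x ∈ Finset.range m, x ∉ a →
    Nat.choose m a.card + layerRank m (insert x a) ≤ layerRank m a + centralSum m := by
  induction m with
  | zero =>
    intro a _ x hx
    simp at hx
  | succ m ih =>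
    intro a ha x hx hxa
    rw [centralSum_succ]
    by_cases hxm : x = m
    · subst hxm
      have h1 := Nat.choose_le_middle a.card x
      rw [layerRank, layerRank, if_pos (Finset.mem_insert_self _ _), if_neg hxa,
        Finset.erase_insert hxa, choose_succ_eq]
      omega
    · have hx' : x ∈ Finset.range m := by
        simp only [Finset.mem_range] at hx ⊢
        omega
      by_cases hma : m ∈ a
      · have h1 := ih _ (erase_subset_range ha) x hx' (fun h => hxa (Finset.mem_of_mem_erase h))
        have h2 := Finset.card_erase_add_one hma
        have h3 := Nat.choose_le_middle a.card m
        rw [layerRank, layerRank, if_pos (Finset.mem_insert_of_mem hma), if_pos hma,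
          Finset.erase_insert_of_ne hxm, ← h2, Nat.choose_succ_succ, Nat.succ_eq_add_one, h2]
        omega
      · have h1 := ih _ (subset_range_of_notMem ha hma) x hx' hxa
        have h3 := Nat.choose_le_middle a.card m
        have h4 : m ∉ insert x a := by
          simp only [Finset.mem_insert, not_or]
          exact ⟨fun h => hxm h.symm, hma⟩
        rw [layerRank, layerRank, if_neg h4, if_neg hma, Finset.card_insert_of_notMem hxa,
          if_neg (Nat.succ_ne_zero _), Nat.add_sub_cancel, choose_succ_eq]
        omega

/-- Numbering of the subsets of `{0, …, m - 1}` by size, then by `layerRank`. -/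
def cubeRank (m : ℕ) (a : Finset ℕ) : ℕ :=
  ∑ j ∈ Finset.range a.card, Nat.choose m j + layerRank m a

lemma cubeRank_lt_of_card_lt {m : ℕ} {a b : Finset ℕ} (ha : a ⊆ Finset.range m)
    (h : a.card < b.card) : cubeRank m a < cubeRank m b := by
  have h1 := layerRank_lt m a ha
  have h2 : ∑ j ∈ Finset.range (a.card + 1), Nat.choose m j ≤
      ∑ j ∈ Finset.range b.card, Nat.choose m j :=
    Finset.sum_le_sum_of_subset (Finset.range_mono h)
  rw [Finset.sum_range_succ] at h2
  unfold cubeRank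
  omega

lemma cubeRank_injOn {m : ℕ} {a b : Finset ℕ} (ha : a ⊆ Finset.range m)
    (hb : b ⊆ Finset.range m) (h : cubeRank m a = cubeRank m b) : a = b := by
  rcases lt_trichotomy a.card b.card with hc | hc | hc
  · exact absurd h (cubeRank_lt_of_card_lt ha hc).ne
  · refine layerRank_injOn m a ha b hb hc ?_
    unfold cubeRank at h
    rw [hc] at h
    omega
  · exact absurd h (cubeRank_lt_of_card_lt hb hc).ne'

lemma cubeRank_lt {m : ℕ} {a : Finset ℕ} (ha : a ⊆ Finset.range m) : cubeRank m a < 2 ^ m := by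
  have h1 := layerRank_lt m a ha
  have h2 := Finset.card_le_card ha
  rw [Finset.card_range] at h2
  have h3 : ∑ j ∈ Finset.range (a.card + 1), Nat.choose m j ≤
      ∑ j ∈ Finset.range (m + 1), Nat.choose m j :=
    Finset.sum_le_sum_of_subset (Finset.range_mono (by omega))
  rw [Finset.sum_range_succ, Nat.sum_range_choose] at h3
  unfold cubeRank
  omega

/-- Only adding an element can raise the rank, and that case is `layerRank_insert_le`. -/
lemma cubeRank_le_add {m : ℕ} {a b : Finset ℕ} (ha : a ⊆ Finset.range m)
    (hb : b ⊆ Finset.range m) (h : (a ∆ b).card ≤ 1) :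
    cubeRank m b ≤ cubeRank m a + centralSum m := by
  rcases lt_trichotomy a.card b.card with hc | hc | hc
  · have hab : a ⊆ b := by
      by_contra hn
      obtain ⟨x, hxa, hxb⟩ := Finset.not_subset.1 hn
      obtain ⟨y, hyb, hya⟩ := Finset.not_subset.1
        (fun h' : b ⊆ a => absurd (Finset.card_le_card h') (by omega))
      have : x = y := Finset.card_le_one.1 h x (by simp [Finset.mem_symmDiff, hxa, hxb])
        y (by simp [Finset.mem_symmDiff, hya, hyb])
      exact hya (this ▸ hxa)
    have h1 : (b \ a).card ≤ 1 := by
      rwa [symmDiff_of_le hab] at h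
    have h2 := Finset.card_sdiff_add_card_eq_card hab
    obtain ⟨x, hx⟩ := Finset.card_eq_one.1 (show (b \ a).card = 1 by omega)
    have hxb : x ∈ b ∧ x ∉ a := Finset.mem_sdiff.1 (hx ▸ Finset.mem_singleton_self x)
    have hb' : b = insert x a := by
      rw [Finset.insert_eq, ← hx, Finset.sdiff_union_of_subset hab]
    have h3 := layerRank_insert_le m a ha x (hb hxb.1) hxb.2
    rw [hb']
    unfold cubeRank
    rw [Finset.card_insert_of_notMem hxb.2, Finset.sum_range_succ]
    omega
  · have hab : a = b := by
      by_contra hne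
      obtain ⟨x, hxa, hxb⟩ := Finset.not_subset.1
        (fun h' : a ⊆ b => hne (Finset.eq_of_subset_of_card_le h' hc.ge))
      obtain ⟨y, hyb, hya⟩ := Finset.not_subset.1
        (fun h' : b ⊆ a => hne (Finset.eq_of_subset_of_card_le h' hc.le).symm)
      have : x = y := Finset.card_le_one.1 h x (by simp [Finset.mem_symmDiff, hxa, hxb])
        y (by simp [Finset.mem_symmDiff, hya, hyb])
      exact hya (this ▸ hxa)
    rw [hab]
    omega
  · have := cubeRank_lt_of_card_lt hb hc
    omega

/-! ### Parity classes as copies of the half cube -/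

/-- The set of positions at which a binary tuple has the entry `true`. -/
def trueSet {n : ℕ} (v : Fin n → Bool) : Finset ℕ :=
  (Finset.univ.filter fun i => v i = true).map Fin.valEmbedding

lemma mem_trueSet {n : ℕ} {v : Fin n → Bool} (i : Fin n) : (i : ℕ) ∈ trueSet v ↔ v i = true := by
  rw [trueSet, Finset.mem_map]
  constructor
  · rintro ⟨j, hj, hji⟩
    have : j = i := Fin.ext hji
    subst this
    exact (Finset.mem_filter.1 hj).2
  · intro h
    exact ⟨i, Finset.mem_filter.2 ⟨Finset.mem_univ _, h⟩, rfl⟩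

lemma trueSet_subset {n : ℕ} (v : Fin n → Bool) : trueSet v ⊆ Finset.range n := by
  intro x hx
  obtain ⟨i, -, rfl⟩ := Finset.mem_map.1 hx
  exact Finset.mem_range.2 i.2

lemma trueSet_injective {n : ℕ} : Function.Injective (trueSet (n := n)) := by
  intro v w h
  funext i
  rw [Bool.eq_iff_iff, ← mem_trueSet, ← mem_trueSet, h]

lemma hammingDist_eq_card_symmDiff {n : ℕ} (v w : Fin n → Bool) :
    hammingDist v w = (trueSet v ∆ trueSet w).card := by
  have : trueSet v ∆ trueSet w = (Finset.univ.filter fun i => v i ≠ w i).map Fin.valEmbedding := by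
    ext x
    by_cases hx : x < n
    · have h1 := mem_trueSet (v := v) ⟨x, hx⟩
      have h2 := mem_trueSet (v := w) ⟨x, hx⟩
      simp only at h1 h2
      rw [Finset.mem_symmDiff, h1, h2, Finset.mem_map]
      constructor
      · intro h
        refine ⟨⟨x, hx⟩, Finset.mem_filter.2 ⟨Finset.mem_univ _, ?_⟩, rfl⟩
        intro he
        rw [he] at h
        tauto
      · rintro ⟨j, hj, hjx⟩
        have : j = ⟨x, hx⟩ := Fin.ext hjx
        subst this
        have h3 := (Finset.mem_filter.1 hj).2
        cases hv : v ⟨x, hx⟩ <;> cases hw : w ⟨x, hx⟩ <;> simp_all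
    · constructor
      · intro h
        rcases Finset.mem_symmDiff.1 h with ⟨h1, -⟩ | ⟨h1, -⟩
        · exact absurd (Finset.mem_range.1 (trueSet_subset v h1)) hx
        · exact absurd (Finset.mem_range.1 (trueSet_subset w h1)) hx
      · intro h
        obtain ⟨j, -, rfl⟩ := Finset.mem_map.1 h
        exact absurd j.2 hx
  rw [this, Finset.card_map]
  rfl

lemma card_symmDiff_mod_two (a b : Finset ℕ) : (a ∆ b).card % 2 = (a.card + b.card) % 2 := by
  have h1 : (a ∆ b).card = (a \ b).card + (b \ a).card :=
    Finset.card_union_of_disjoint disjoint_sdiff_sdiff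
  have h2 := Finset.card_sdiff_add_card_inter a b
  have h3 := Finset.card_sdiff_add_card_inter b a
  rw [Finset.inter_comm] at h3
  omega

section halfCube

variable {m : ℕ}

/-- The projection of the vertices of the `(m + 1)`-cube to the `m`-cube. -/
def halfSet (v : Fin (m + 1) → Bool) : Finset ℕ := (trueSet v).erase m

lemma halfSet_subset (v : Fin (m + 1) → Bool) : halfSet v ⊆ Finset.range m :=
  erase_subset_range (trueSet_subset v)

lemma halfSet_symmDiff (v w : Fin (m + 1) → Bool) :
    halfSet v ∆ halfSet w = (trueSet v ∆ trueSet w).erase m := by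
  ext z
  simp only [halfSet, Finset.mem_symmDiff, Finset.mem_erase]
  tauto

/-- Equal parity makes the symmetric difference even, so it cannot consist of the deleted coordinate
alone. -/
lemma halfSet_injOn {v w : Fin (m + 1) → Bool}
    (hp : (trueSet v).card % 2 = (trueSet w).card % 2) (h : halfSet v = halfSet w) : v = w := by
  have h1 := halfSet_symmDiff v w
  rw [h, symmDiff_self] at h1
  have h2 : (trueSet v ∆ trueSet w).card - 1 ≤ ((trueSet v ∆ trueSet w).erase m).card :=
    Finset.pred_card_le_card_erase
  rw [← h1] at h2
  have h3 := card_symmDiff_mod_two (trueSet v) (trueSet w)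
  have h4 : (⊥ : Finset ℕ).card = 0 := rfl
  have h5 : (trueSet v ∆ trueSet w).card = 0 := by omega
  exact trueSet_injective (symmDiff_eq_bot.1 (Finset.card_eq_zero.1 h5))

lemma card_image_halfSet {b : ℕ} {X : Finset (Fin (m + 1) → Bool)}
    (hX : ∀ v ∈ X, (trueSet v).card % 2 = b) : (X.image halfSet).card = X.card :=
  Finset.card_image_of_injOn fun v hv w hw h => halfSet_injOn ((hX v hv).trans (hX w hw).symm) h

lemma image_halfSet_subset (X : Finset (Fin (m + 1) → Bool)) :
    X.image halfSet ⊆ (Finset.range m).powerset := by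
  intro a ha
  obtain ⟨v, -, rfl⟩ := Finset.mem_image.1 ha
  exact Finset.mem_powerset.2 (halfSet_subset v)

/-- Nonadjacent sets of vertices of opposite parities, one of them of the size of
`peakFamily m`, miss at least `centralSum m` vertices of the half cube. -/
lemma card_add_card_le_of_not_adj {b b' : ℕ} (hb : b % 2 ≠ b' % 2)
    {X Y : Finset (Fin (m + 1) → Bool)}
    (hX : ∀ v ∈ X, (trueSet v).card % 2 = b) (hY : ∀ v ∈ Y, (trueSet v).card % 2 = b')
    (hXY : ∀ v ∈ X, ∀ w ∈ Y, ¬ (hypercubeGraph (m + 1)).Adj v w)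
    (hcard : X.card = (peakFamily m).card ∨ Y.card = (peakFamily m).card) :
    X.card + Y.card + centralSum m ≤ 2 ^ m := by
  have hsep : Separated (X.image halfSet) (Y.image halfSet) := by
    intro a ha c hc
    obtain ⟨v, hv, rfl⟩ := Finset.mem_image.1 ha
    obtain ⟨w, hw, rfl⟩ := Finset.mem_image.1 hc
    by_contra! hlt
    -- Projections within distance 1 come from vertices within distance 2, and opposite parity makes
    -- that distance odd.
    rw [halfSet_symmDiff] at hlt
    have h2 : (trueSet v ∆ trueSet w).card - 1 ≤ ((trueSet v ∆ trueSet w).erase m).card :=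
      Finset.pred_card_le_card_erase
    have h3 := card_symmDiff_mod_two (trueSet v) (trueSet w)
    have h4 := hX v hv
    have h5 := hY w hw
    refine hXY v hv w hw ?_
    change hammingDist v w = 1
    rw [hammingDist_eq_card_symmDiff]
    omega
  rw [← card_image_halfSet hX, ← card_image_halfSet hY] at hcard ⊢
  rcases hcard with h | h
  · exact card_add_card_le_of_separated (image_halfSet_subset X) (image_halfSet_subset Y) hsep h
  · have := card_add_card_le_of_separated (image_halfSet_subset Y) (image_halfSet_subset X)
      hsep.symm h
    omega

lemma parity_ne_of_adj {v w : Fin (m + 1) → Bool} (h : (hypercubeGraph (m + 1)).Adj v w) :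
    (trueSet v).card % 2 ≠ (trueSet w).card % 2 := by
  have h1 : hammingDist v w = 1 := h
  rw [hammingDist_eq_card_symmDiff] at h1
  have h3 := card_symmDiff_mod_two (trueSet v) (trueSet w)
  omega

lemma card_halfSet_symmDiff_of_adj {v w : Fin (m + 1) → Bool}
    (h : (hypercubeGraph (m + 1)).Adj v w) : (halfSet v ∆ halfSet w).card ≤ 1 := by
  have h1 : hammingDist v w = 1 := h
  rw [hammingDist_eq_card_symmDiff] at h1
  rw [halfSet_symmDiff]
  exact Finset.card_erase_le.trans h1.le

lemma card_vertices : Fintype.card (Fin (m + 1) → Bool) = 2 * 2 ^ m := by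
  simp [pow_succ, mul_comm]

/-! ### Label windows and the upper bound -/

/-- The number of vertices of parity `b` with label at most `x`. -/
def parityCount (η : (Fin (m + 1) → Bool) → ℕ) (b x : ℕ) : ℤ :=
  ((Finset.univ.filter fun v => (trueSet v).card % 2 = b ∧ η v ≤ x).card : ℤ)

lemma card_parity_window (η : (Fin (m + 1) → Bool) → ℕ) (b : ℕ) {x y : ℕ} (hxy : x ≤ y) :
    ((Finset.univ.filter fun v => (trueSet v).card % 2 = b ∧ x < η v ∧ η v ≤ y).card : ℤ) =
      parityCount η b y - parityCount η b x := by
  have h1 := Finset.card_filter_add_card_filter_not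
    (s := Finset.univ.filter fun v => (trueSet v).card % 2 = b ∧ η v ≤ y) (fun v => η v ≤ x)
  rw [Finset.filter_filter, Finset.filter_filter] at h1
  have h2 : (Finset.univ.filter fun v => ((trueSet v).card % 2 = b ∧ η v ≤ y) ∧ η v ≤ x) =
      Finset.univ.filter fun v => (trueSet v).card % 2 = b ∧ η v ≤ x :=
    Finset.filter_congr fun v _ => by omega
  have h3 : (Finset.univ.filter fun v => ((trueSet v).card % 2 = b ∧ η v ≤ y) ∧ ¬ η v ≤ x) =
      Finset.univ.filter fun v => (trueSet v).card % 2 = b ∧ x < η v ∧ η v ≤ y :=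
    Finset.filter_congr fun v _ => by omega
  rw [h2, h3] at h1
  unfold parityCount
  omega

lemma parityCount_mono (η : (Fin (m + 1) → Bool) → ℕ) (b : ℕ) : Monotone (parityCount η b) := by
  intro x y hxy
  have := card_parity_window η b hxy
  omega

lemma card_parity_le (b : ℕ) (X : Finset (Fin (m + 1) → Bool))
    (hX : ∀ v ∈ X, (trueSet v).card % 2 = b) : X.card ≤ 2 ^ m := by
  have h := Finset.card_le_card (image_halfSet_subset X)
  rwa [card_image_halfSet hX, Finset.card_powerset, Finset.card_range] at h

lemma IsNumbering.card_le {η : (Fin (m + 1) → Bool) → ℕ} (hη : IsNumbering η) {x : ℕ}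
    (hx : x ≤ 2 * 2 ^ m) : (Finset.univ.filter fun v => η v ≤ x).card = x := by
  have h1 : (Finset.univ.filter fun v => η v ≤ x).image η = Finset.Icc 1 x := by
    ext y
    simp only [Finset.mem_image, Finset.mem_filter, Finset.mem_univ, true_and, Finset.mem_Icc]
    constructor
    · rintro ⟨v, hv, rfl⟩
      exact ⟨(hη.mapsTo (Set.mem_univ v)).1, hv⟩
    · rintro ⟨h1, h2⟩
      obtain ⟨v, -, rfl⟩ := hη.surjOn (show y ∈ Set.Icc 1 (Fintype.card (Fin (m + 1) → Bool)) from
        ⟨h1, by rw [card_vertices]; omega⟩)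
      exact ⟨v, h2, rfl⟩
  have h2 := Finset.card_image_of_injOn (s := Finset.univ.filter fun v => η v ≤ x) (f := η)
    (fun v _ w _ h => hη.injOn (Set.mem_univ v) (Set.mem_univ w) h)
  rw [h1, Nat.card_Icc] at h2
  omega

lemma IsNumbering.balancedCounts {η : (Fin (m + 1) → Bool) → ℕ} (hη : IsNumbering η) :
    BalancedCounts (2 ^ m) (parityCount η 0) (parityCount η 1) := by
  have hadd : ∀ x ≤ 2 * 2 ^ m, parityCount η 0 x + parityCount η 1 x = x := by
    intro x hx
    have h1 := Finset.card_filter_add_card_filter_not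
      (s := Finset.univ.filter fun v => η v ≤ x) (fun v => (trueSet v).card % 2 = 0)
    rw [Finset.filter_filter, Finset.filter_filter, hη.card_le hx] at h1
    have h2 : (Finset.univ.filter fun v => η v ≤ x ∧ (trueSet v).card % 2 = 0) =
        Finset.univ.filter fun v => (trueSet v).card % 2 = 0 ∧ η v ≤ x :=
      Finset.filter_congr fun v _ => by omega
    have h3 : (Finset.univ.filter fun v => η v ≤ x ∧ ¬ (trueSet v).card % 2 = 0) =
        Finset.univ.filter fun v => (trueSet v).card % 2 = 1 ∧ η v ≤ x :=
      Finset.filter_congr fun v _ => by omega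
    rw [h2, h3] at h1
    unfold parityCount
    omega
  -- Each class has at most half of the vertices and together they have all, so both bounds are
  -- attained.
  have hle : ∀ b, parityCount η b (2 * 2 ^ m) ≤ ((2 ^ m : ℕ) : ℤ) := by
    intro b
    have h := card_parity_le b
      (Finset.univ.filter fun v => (trueSet v).card % 2 = b ∧ η v ≤ 2 * 2 ^ m)
      fun v hv => (Finset.mem_filter.1 hv).2.1
    unfold parityCount
    exact_mod_cast h
  have h0 := hle 0
  have h1 := hle 1
  have h2 := hadd _ le_rfl
  push_cast at h0 h1 h2
  refine ⟨parityCount_mono η 0, parityCount_mono η 1, ?_, ?_, hadd, ?_, ?_⟩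
  · unfold parityCount; positivity
  · unfold parityCount; positivity
  · push_cast; linarith
  · push_cast; linarith

/-- Labels in (j, i + k] and (i, j + k] differ by less than k, so no edge joins the two windows.
Harper's inequality then excludes p and q vertices in them, since p + q = k is one more than it
allows. -/
lemma windowFree_parityCount {η : (Fin (m + 1) → Bool) → ℕ} {k : ℕ}
    (hk : k + centralSum m = 2 ^ m + 1)
    (hedge : ∀ v w, (hypercubeGraph (m + 1)).Adj v w → (k : ℤ) ≤ |(η v : ℤ) - (η w : ℤ)|)
    {b b' : ℕ} (hb : b % 2 ≠ b' % 2) {p q : ℕ} (hpq : p + q = k)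
    (hs : p = (peakFamily m).card ∨ q = (peakFamily m).card) :
    WindowFree (2 ^ m) k p q (parityCount η b) (parityCount η b') := by
  intro i j hij hji _ hp
  by_contra! hq
  set X := Finset.univ.filter fun v => (trueSet v).card % 2 = b ∧ j < η v ∧ η v ≤ i + k with hX
  set Y := Finset.univ.filter fun v => (trueSet v).card % 2 = b' ∧ i < η v ∧ η v ≤ j + k with hY
  have hXc : X.card = p := by
    have : (X.card : ℤ) = _ := card_parity_window η b hji
    omega
  have hYc : q ≤ Y.card := by
    have : (Y.card : ℤ) = _ := card_parity_window η b' (show i ≤ j + k by omega)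
    omega
  -- Harper's inequality is available only at one exact size, so the second set is trimmed to `q`
  -- members.
  obtain ⟨Z, hZY, hZ⟩ := Finset.exists_subset_card_eq hYc
  have := card_add_card_le_of_not_adj hb (X := X) (Y := Z)
    (fun v hv => (Finset.mem_filter.1 hv).2.1) (fun v hv => (Finset.mem_filter.1 (hZY hv)).2.1)
    (fun v hv w hw hadj => by
      have h1 := (Finset.mem_filter.1 hv).2.2
      have h2 := (Finset.mem_filter.1 (hZY hw)).2.2
      have h3 := hedge v w hadj
      rw [le_abs] at h3
      omega)
    (by rw [hXc, hZ]; exact hs)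
  omega

lemma card_peakFamily_pos (m : ℕ) : 0 < (peakFamily m).card := by
  induction m with
  | zero => simp [peakFamily]
  | succ m ih =>
    rw [card_peakFamily_succ]
    omega

/-- No numbering has all label differences across edges larger than `2 ^ m - centralSum m`. -/
theorem IsNumbering.exists_adj_le {η : (Fin (m + 1) → Bool) → ℕ} (hη : IsNumbering η)
    (hm : 0 < m) : ∃ v w, (hypercubeGraph (m + 1)).Adj v w ∧
      |(η v : ℤ) - (η w : ℤ)| ≤ 2 ^ m - centralSum m := by
  by_contra! hcon
  -- The empty second family gives s + c ≤ 2^m, which makes `t` below positive.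
  have hs := card_add_card_peakFamily_le m ∅ (Finset.empty_subset _)
    (fun a _ b hb => absurd hb (Finset.notMem_empty b))
  rw [Finset.card_empty, zero_add] at hs
  have hpos := card_peakFamily_pos m
  obtain ⟨hb1, hb2⟩ := card_peakFamily_bounds m
  have hc : 1 ≤ centralSum m := by
    have := Finset.single_le_sum (f := fun j => Nat.choose j (j / 2))
      (fun _ _ => Nat.zero_le _) (Finset.mem_range.2 hm)
    simpa [centralSum] using this
  obtain ⟨k, hk⟩ : ∃ k, k + centralSum m = 2 ^ m + 1 := ⟨2 ^ m + 1 - centralSum m, by omega⟩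
  obtain ⟨t, ht⟩ : ∃ t, (peakFamily m).card + t = k := ⟨k - (peakFamily m).card, by omega⟩
  have hedge : ∀ v w, (hypercubeGraph (m + 1)).Adj v w → (k : ℤ) ≤ |(η v : ℤ) - (η w : ℤ)| := by
    intro v w h
    have := hcon v w h
    zify at hk
    omega
  have hbal := hη.balancedCounts
  have h01 : 0 % 2 ≠ 1 % 2 := by decide
  have ht' : t + (peakFamily m).card = k := by omega
  rcases le_total t (peakFamily m).card with h | h
  · exact hbal.false_of_windowFree (k := k) (p := ((peakFamily m).card : ℕ)) (q := (t : ℕ))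
      (by omega) (by omega) (by omega) (by omega) (by omega)
      (windowFree_parityCount hk hedge h01 ht (Or.inl rfl))
      (windowFree_parityCount hk hedge h01 ht' (Or.inr rfl))
      (windowFree_parityCount hk hedge h01.symm ht (Or.inl rfl))
      (windowFree_parityCount hk hedge h01.symm ht' (Or.inr rfl))
  · exact hbal.false_of_windowFree (k := k) (p := (t : ℕ)) (q := ((peakFamily m).card : ℕ))
      (by omega) (by omega) (by omega) (by omega) (by omega)
      (windowFree_parityCount hk hedge h01 ht' (Or.inr rfl))
      (windowFree_parityCount hk hedge h01 ht (Or.inl rfl))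
      (windowFree_parityCount hk hedge h01.symm ht' (Or.inr rfl))
      (windowFree_parityCount hk hedge h01.symm ht (Or.inl rfl))

/-! ### The optimal numbering and the theorem -/

/-- The optimal labels: the even vertices come first, in the reversed order of `cubeRank`, and the
odd vertices follow, in the same order. -/
def optimalLabel (v : Fin (m + 1) → Bool) : ℕ :=
  if (trueSet v).card % 2 = 0 then 2 ^ m - cubeRank m (halfSet v)
  else 2 * 2 ^ m - cubeRank m (halfSet v)

lemma isNumbering_optimalLabel : IsNumbering (optimalLabel (m := m)) := by
  have hlt : ∀ v : Fin (m + 1) → Bool, cubeRank m (halfSet v) < 2 ^ m :=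
    fun v => cubeRank_lt (halfSet_subset v)
  have hmaps : ∀ v : Fin (m + 1) → Bool, optimalLabel v ∈ Finset.Icc 1 (2 * 2 ^ m) := by
    intro v
    have := hlt v
    rw [Finset.mem_Icc]
    unfold optimalLabel
    split_ifs <;> omega
  have hinj : Function.Injective (optimalLabel (m := m)) := by
    intro v w h
    have h1 := hlt v
    have h2 := hlt w
    have h3 : (trueSet v).card % 2 = (trueSet w).card % 2 ∧
        cubeRank m (halfSet v) = cubeRank m (halfSet w) := by
      unfold optimalLabel at h
      split_ifs at h <;> omega
    exact halfSet_injOn h3.1 (cubeRank_injOn (halfSet_subset v) (halfSet_subset w) h3.2)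
  have himage : Finset.univ.image (optimalLabel (m := m)) = Finset.Icc 1 (2 * 2 ^ m) := by
    refine Finset.eq_of_subset_of_card_le ?_ ?_
    · intro y hy
      obtain ⟨v, -, rfl⟩ := Finset.mem_image.1 hy
      exact hmaps v
    · rw [Finset.card_image_of_injective _ hinj, Finset.card_univ, card_vertices, Nat.card_Icc]
      omega
  unfold IsNumbering
  rw [card_vertices]
  refine ⟨fun v _ => Finset.mem_Icc.1 (hmaps v), hinj.injOn, ?_⟩
  intro y hy
  have hy' : y ∈ Finset.univ.image (optimalLabel (m := m)) := by
    rw [himage]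
    exact Finset.mem_Icc.2 hy
  obtain ⟨v, -, rfl⟩ := Finset.mem_image.1 hy'
  exact ⟨v, Set.mem_univ v, rfl⟩

/-- Adjacent vertices lie in opposite halves of the label range, so their labels differ by `2 ^ m`
up to a rank difference of at most `centralSum m`. -/
lemma le_abs_optimalLabel_sub {v w : Fin (m + 1) → Bool}
    (h : (hypercubeGraph (m + 1)).Adj v w) :
    (2 : ℤ) ^ m - centralSum m ≤ |(optimalLabel v : ℤ) - (optimalLabel w : ℤ)| := by
  have h1 := cubeRank_lt (halfSet_subset v)
  have h2 := cubeRank_lt (halfSet_subset w)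
  have h3 := card_halfSet_symmDiff_of_adj h
  have h4 := cubeRank_le_add (halfSet_subset v) (halfSet_subset w) h3
  rw [symmDiff_comm] at h3
  have h5 := cubeRank_le_add (halfSet_subset w) (halfSet_subset v) h3
  have h6 := parity_ne_of_adj h
  have h7 : ((2 ^ m : ℕ) : ℤ) = 2 ^ m := by push_cast; rfl
  rw [le_abs]
  unfold optimalLabel
  split_ifs <;> omega

lemma exists_adj : ∃ v w, (hypercubeGraph (m + 1)).Adj v w := by
  refine ⟨fun _ => false, Function.update (fun _ => false) 0 true, ?_⟩
  change hammingDist _ _ = 1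
  rw [hammingDist, Finset.card_eq_one]
  refine ⟨0, ?_⟩
  ext i
  simp [Function.update_apply]

end halfCube

theorem theorem3 (n : ℕ) (hn : 1 ≤ n) :
    IsAntibandwidth (hypercubeGraph n)
      ((2 : ℤ) ^ (n - 1) - ∑ m ∈ Finset.range (n - 1), (Nat.choose m (m / 2) : ℤ)) := by
  obtain ⟨m, rfl⟩ : ∃ m, n = m + 1 := ⟨n - 1, by omega⟩
  have hsum : ∑ j ∈ Finset.range m, (Nat.choose j (j / 2) : ℤ) = (centralSum m : ℤ) := by
    rw [centralSum]
    push_cast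
    rfl
  rw [Nat.add_sub_cancel, hsum]
  have hupper : ∀ d ∈ {d : ℤ | ∃ η : (Fin (m + 1) → Bool) → ℕ, IsNumbering η ∧
      IsLeast (edgeLabelDiffs (hypercubeGraph (m + 1)) η) d}, d ≤ 2 ^ m - centralSum m := by
    rintro d ⟨η, hη, hd⟩
    -- For n = 1 the only labels are 1 and 2. The window argument needs `centralSum m ≥ 1` to have k
    -- ≤ 2^m.
    rcases Nat.eq_zero_or_pos m with rfl | hm
    · obtain ⟨v, w, -, rfl⟩ := hd.1
      have h1 := hη.mapsTo (Set.mem_univ v)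
      have h2 := hη.mapsTo (Set.mem_univ w)
      rw [card_vertices, Set.mem_Icc] at h1 h2
      simp only [centralSum, Finset.range_zero, Finset.sum_empty, pow_zero] at h1 h2 ⊢
      rw [abs_le]
      omega
    · obtain ⟨v, w, hadj, hle⟩ := hη.exists_adj_le hm
      exact (hd.2 ⟨v, w, hadj, rfl⟩).trans hle
  refine ⟨?_, hupper⟩
  have hlower : ∀ d ∈ edgeLabelDiffs (hypercubeGraph (m + 1)) (optimalLabel (m := m)),
      (2 : ℤ) ^ m - centralSum m ≤ d := by
    rintro d ⟨v, w, hadj, rfl⟩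
    exact le_abs_optimalLabel_sub hadj
  obtain ⟨v, w, hadj⟩ := exists_adj (m := m)
  obtain ⟨d, hd, hmin⟩ := Int.exists_least_of_bdd
    (P := fun d => d ∈ edgeLabelDiffs (hypercubeGraph (m + 1)) (optimalLabel (m := m)))
    ⟨_, hlower⟩ ⟨_, v, w, hadj, rfl⟩
  have hmem : d ∈ {d : ℤ | ∃ η : (Fin (m + 1) → Bool) → ℕ, IsNumbering η ∧
      IsLeast (edgeLabelDiffs (hypercubeGraph (m + 1)) η) d} :=
    ⟨optimalLabel, isNumbering_optimalLabel, hd, hmin⟩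
  rwa [le_antisymm (hupper d hmem) (hlower d hd)] at hmem
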